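/- Let $m\in\mathbb N_0$, let $\omega_r,\omega_p,l_d,l_r,l_p,n_d,n_r,n_p\ge 0$ be real constants, and let $(\tilde p_k)_{k\ge 0}$ be a sequence in $[0,1]$ with $\sum_{k=0}^\infty \tilde p_k=1$. Put $\tilde h(x)=\sum_{k=0}^\infty \tilde p_k x^k$. Suppose that the radius of convergence of this power series is strictly greater than $1$ and that $\tilde h'(1)\neq 0$. For an open set $\mathcal D\subset\mathbb R\times\mathbb R_{\ge 0}$ containing $\{1\}\times\mathbb R_{>0}$, a solution of the nonlocal problem on $\mathcal D$ is a function $G\colon \mathcal D\cup\{(x,0)\in\partial\mathcal D\}\to\mathbb R$ that is continuous, is differentiable in $\mathcal D$, has $G_x(1,t)\ne 0$ for all $t>0$, and satisfies $$\begin{aligned}G_t(x,t)&=(x-1)\Big[x\Big(\omega_p+\frac{2l_p+n_pm}{G_x(1,t)}\Big)-\omega_r-\omega_p-l_d-n_dG_x(1,t)\Big]G_x(x,t)\\&\quad+\big[(x-1)(\omega_rG_x(1,t)+2l_r+n_rm)-n_r-n_p\big]G(x,t)+(n_r+n_p)x^m\end{aligned}$$ for all $(x,t)\in\mathcal D$,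 and $G(x,0)=\sum_{k=0}^\infty \tilde p_kx^k$ (in particular, the series converges) for all $(x,0)\in\partial\mathcal D$. Then there exist an open set $\mathcal D\subset\mathbb R\times\mathbb R_{\ge 0}$ containing $[-1,1]\times\mathbb R_{>0}$ and a solution $G$ of the nonlocal problem on $\mathcal D$ with $G\in C^\infty(\mathcal D)$. Moreover, this solution is unique in the class $C^2(\mathcal D)$: every solution $F$ of the nonlocal problem on $\mathcal D$ with $F\in C^2(\mathcal D)$ coincides with $G$ on $\mathcal D$. -/

import Mathlib

open scoped ContDiff

/-- The parameters of the network model: the nonnegative rates of the individual processes, and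
the degree `m` of newly introduced nodes. -/
structure NetworkRates where
  /-- random rewiring -/
  ωr : ℝ
  /-- preferential rewiring -/
  ωp : ℝ
  /-- deletion of links -/
  ld : ℝ
  /-- random addition of links -/
  lr : ℝ
  /-- preferential addition of links -/
  lp : ℝ
  /-- deletion of nodes -/
  nd : ℝ
  /-- random addition of nodes -/
  nr : ℝ
  /-- addition of nodes by preferential attachment -/
  np : ℝ
  /-- degree of a new node -/
  m : ℕ
  ωr_nonneg : 0 ≤ ωr
  ωp_nonneg : 0 ≤ ωp
  ld_nonneg : 0 ≤ ld
  lr_nonneg : 0 ≤ lr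
  lp_nonneg : 0 ≤ lp
  nd_nonneg : 0 ≤ nd
  nr_nonneg : 0 ≤ nr
  np_nonneg : 0 ≤ np

/-- The generating function `x ↦ ∑ₖ pₖ xᵏ` of a real sequence. -/
noncomputable def genFun (p : ℕ → ℝ) (x : ℝ) : ℝ := ∑' k, p k * x ^ k

/-- The radius of convergence of the power series `∑ₖ pₖ xᵏ`. -/
noncomputable def genRadius (p : ℕ → ℝ) : ENNReal :=
  (FormalMultilinearSeries.ofScalars ℝ p).radius

/-- The partial derivative `G_x (x, t)`. -/
noncomputable def partialX (G : ℝ × ℝ → ℝ) (x t : ℝ) : ℝ := deriv (fun y => G (y, t)) x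

/-- The partial derivative `G_t (x, t)`. -/
noncomputable def partialT (G : ℝ × ℝ → ℝ) (x t : ℝ) : ℝ := deriv (fun s => G (x, s)) t

/-- The part of the boundary of `D` that lies on the line `t = 0`. -/
def initialBoundary (D : Set (ℝ × ℝ)) : Set (ℝ × ℝ) := {z | z ∈ frontier D ∧ z.2 = 0}

/-- The right-hand side of the nonlocal equation at the point `(x, t)`. -/
noncomputable def nonlocalRHS (P : NetworkRates) (G : ℝ × ℝ → ℝ) (x t : ℝ) : ℝ :=
  (x - 1) * (x * (P.ωp + (2 * P.lp + P.np * P.m) / partialX G 1 t)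
      - P.ωr - P.ωp - P.ld - P.nd * partialX G 1 t) * partialX G x t
    + ((x - 1) * (P.ωr * partialX G 1 t + 2 * P.lr + P.nr * P.m) - P.nr - P.np) * G (x, t)
    + (P.nr + P.np) * x ^ P.m

/-- `D` is an admissible domain: an open subset of the plane contained in the closed upper half
plane and containing the half-line `{1} × (0, ∞)`. -/
structure IsAdmissibleDomain (D : Set (ℝ × ℝ)) : Prop where
  isOpen : IsOpen D
  subset_halfPlane : ∀ z ∈ D, 0 ≤ z.2
  line_mem : ∀ t : ℝ, 0 < t → ((1 : ℝ), t) ∈ D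

/-- `G` is a (classical) solution on `D` of the nonlocal initial value problem with initial
probabilities `p`. Only the values of `G` on `D` and on `initialBoundary D` matter.
The initial values are attained continuously (otherwise the initial condition would not
be related to the equation, as `D` is open), and the denominator `G_x (1, t)` in the equation
does not vanish. -/
structure IsNonlocalSolution (P : NetworkRates) (p : ℕ → ℝ) (D : Set (ℝ × ℝ))
    (G : ℝ × ℝ → ℝ) : Prop where
  domain : IsAdmissibleDomain D
  differentiable : DifferentiableOn ℝ G D
  continuous : ContinuousOn G (D ∪ initialBoundary D)
  denom_ne_zero : ∀ t : ℝ, 0 < t → partialX G 1 t ≠ 0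
  equation : ∀ x t : ℝ, (x, t) ∈ D → partialT G x t = nonlocalRHS P G x t
  initial : ∀ x : ℝ, (x, (0 : ℝ)) ∈ frontier D → HasSum (fun k => p k * x ^ k) (G (x, 0))

/-! Put v(t) = G_x(1,t), q = 2 l_p + n_p m and n = n_r + n_p. For known v the equation is a linear
transport equation with field (x-1)((x-1)β+γ), growth rate (x-1)δ - n and source n x^m, where β =
ω_p + q/v, γ = q/v - ω_r - l_d - n_d v and δ = ω_r v + 2 l_r + n_r m. The nonlocal term closes on
itself: at x = 1 the equation reads G_t = -n(G-1), so G(1,t) = 1, and its x-derivative there loses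
G_xx to the factor x-1, which leaves a Riccati equation v' = A - Bv - n_d v² with A, B ≥ 0
(`hasDerivAt_partialX_one`, `linear_eq_riccati`).

Existence. The Riccati solution u with u(0) = h'(1) > 0, h the initial generating function, stays
positive for all t ≥ 0 (`exists_riccati`). With coefficients built from u the characteristics obey a
Bernoulli equation and are explicit. Since 0 ≤ β and γ ≤ β, those through [-1,1] start in [-1,1]
(`mem_transportDomain`), and a radius of convergence above 1 leaves room for an open domain. The
x-derivative at 1 of the resulting G solves the same linear equation as u, hence equals u
(`partialX_transportSol_one`), so G solves the nonlocal problem.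

Uniqueness. A C² solution F is only continuous up to t = 0, so v = F_x(1,·) solves the Riccati
equation for t > 0 with no given initial value. That v(t) → h'(1) is the main difficulty, because v
could blow up or tend to 0, making the coefficients singular. Comparison along backward
characteristics near x = 1 bounds v from above and away from 0 (`partialX_bounds`). Then the
coefficients are bounded, and a Gronwall argument gives the limit
(`IsTransportSolution.tendsto_partialX`). Hence v = u (`riccati_unique`), F and G solve the same
transport equation, and they agree along characteristics (`transport_unique`). -/

/-! ### Smoothness of integrals depending on a parameter. -/

section ParametricIntegral

open Set Filter Topology MeasureTheory

variable {E : Type} [NormedAddCommGroup E] {F : Type} [NormedAddCommGroup F]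

theorem aestronglyMeasurable_slice {V : Set (E × ℝ)} {ψ : E × ℝ → F}
    (hψ : ContinuousOn ψ V) {q : E} (hq : ∀ σ ∈ Icc (0 : ℝ) 1, (q, σ) ∈ V) :
    AEStronglyMeasurable (fun σ => ψ (q, σ)) (volume.restrict (uIoc (0 : ℝ) 1)) := by
  have : ContinuousOn (fun σ => ψ (q, σ)) (Icc (0 : ℝ) 1) :=
    hψ.comp (by fun_prop) hq
  rw [uIoc_of_le zero_le_one]
  exact (this.mono Ioc_subset_Icc_self).aestronglyMeasurable measurableSet_Ioc

variable [ProperSpace E]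

/-- A function continuous near `{p} × [0, 1]` is bounded near this set. -/
theorem exists_ball_bound_of_continuousOn {V : Set (E × ℝ)} (hV : IsOpen V) {ψ : E × ℝ → F}
    (hψ : ContinuousOn ψ V) {p : E} (hp : ∀ σ ∈ Icc (0 : ℝ) 1, (p, σ) ∈ V) :
    ∃ ε > 0, ∃ C : ℝ, ∀ q ∈ Metric.ball p ε, ∀ σ ∈ Icc (0 : ℝ) 1,
      (q, σ) ∈ V ∧ ‖ψ (q, σ)‖ ≤ C := by
  obtain ⟨u, v, hu, hv, hpu, hIv, huv⟩ := generalized_tube_lemma (s := {p}) isCompact_singleton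
    (t := Icc (0 : ℝ) 1) isCompact_Icc hV (by
      rintro ⟨a, b⟩ ⟨ha, hb⟩
      simp only [mem_singleton_iff] at ha
      subst ha
      exact hp b hb)
  obtain ⟨ε, hε, hball⟩ := Metric.isOpen_iff.1 hu p (hpu rfl)
  have hsub : Metric.closedBall p (ε / 2) ×ˢ Icc (0 : ℝ) 1 ⊆ V := by
    rintro ⟨a, b⟩ ⟨ha, hb⟩
    exact huv ⟨hball (Metric.closedBall_subset_ball (by linarith) ha), hIv hb⟩
  obtain ⟨C, hC⟩ := ((isCompact_closedBall p (ε / 2)).prod isCompact_Icc).exists_bound_of_continuousOn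
    (hψ.mono hsub)
  refine ⟨ε / 2, by linarith, C, fun q hq σ hσ => ?_⟩
  have hmem : (q, σ) ∈ Metric.closedBall p (ε / 2) ×ˢ Icc (0 : ℝ) 1 :=
    ⟨Metric.ball_subset_closedBall hq, hσ⟩
  exact ⟨hsub hmem, hC _ hmem⟩

variable [NormedSpace ℝ F]

theorem continuousOn_parametric_integral {V : Set (E × ℝ)} (hV : IsOpen V) {ψ : E × ℝ → F}
    (hψ : ContinuousOn ψ V) {Ω : Set E} (hΩ : ∀ p ∈ Ω, ∀ σ ∈ Icc (0 : ℝ) 1, (p, σ) ∈ V) :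
    ContinuousOn (fun p => ∫ σ in (0 : ℝ)..1, ψ (p, σ)) Ω := by
  intro p hp
  apply ContinuousAt.continuousWithinAt
  obtain ⟨ε, hε, C, hC⟩ := exists_ball_bound_of_continuousOn hV hψ (hΩ p hp)
  have hnear : ∀ᶠ q in 𝓝 p, q ∈ Metric.ball p ε := Metric.ball_mem_nhds p hε
  apply intervalIntegral.continuousAt_of_dominated_interval (bound := fun _ => C)
  · filter_upwards [hnear] with q hq
    exact aestronglyMeasurable_slice hψ fun σ hσ => (hC q hq σ hσ).1
  · filter_upwards [hnear] with q hq
    refine Eventually.of_forall fun σ hσ => (hC q hq σ ?_).2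
    rw [uIoc_of_le zero_le_one] at hσ
    exact Ioc_subset_Icc_self hσ
  · exact intervalIntegrable_const
  · refine Eventually.of_forall fun σ hσ => ?_
    rw [uIoc_of_le zero_le_one] at hσ
    have h1 : ContinuousAt ψ (p, σ) :=
      hψ.continuousAt (hV.mem_nhds (hΩ p hp σ (Ioc_subset_Icc_self hσ)))
    exact h1.comp (f := fun q : E => (q, σ)) (by fun_prop)

variable [NormedSpace ℝ E]

theorem hasFDerivAt_parametric_integral {V : Set (E × ℝ)} (hV : IsOpen V) {ψ : E × ℝ → F}
    (hψ : ContDiffOn ℝ 1 ψ V) {p : E} (hp : ∀ σ ∈ Icc (0 : ℝ) 1, (p, σ) ∈ V) :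
    HasFDerivAt (fun p => ∫ σ in (0 : ℝ)..1, ψ (p, σ))
      (∫ σ in (0 : ℝ)..1, (fderiv ℝ ψ (p, σ)).comp (ContinuousLinearMap.inl ℝ E ℝ)) p := by
  have hc' : ContinuousOn (fun z => (fderiv ℝ ψ z).comp (ContinuousLinearMap.inl ℝ E ℝ)) V :=
    (hψ.continuousOn_fderiv_of_isOpen hV le_rfl).clm_comp continuousOn_const
  obtain ⟨ε, hε, C, hC⟩ := exists_ball_bound_of_continuousOn hV hc' hp
  have hnear : ∀ᶠ q in 𝓝 p, q ∈ Metric.ball p ε := Metric.ball_mem_nhds p hε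
  have hmem : ∀ σ ∈ uIoc (0 : ℝ) 1, σ ∈ Icc (0 : ℝ) 1 := fun σ hσ => by
    rw [uIoc_of_le zero_le_one] at hσ
    exact Ioc_subset_Icc_self hσ
  refine (intervalIntegral.hasFDerivAt_integral_of_dominated_of_fderiv_le
    (F := fun q σ => ψ (q, σ))
    (F' := fun q σ => (fderiv ℝ ψ (q, σ)).comp (ContinuousLinearMap.inl ℝ E ℝ))
    (bound := fun _ => C) (s := Metric.ball p ε) hnear ?_ ?_ ?_ ?_ ?_ ?_)
  · filter_upwards [hnear] with q hq
    exact aestronglyMeasurable_slice hψ.continuousOn fun σ hσ => (hC q hq σ hσ).1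
  · apply ContinuousOn.intervalIntegrable
    rw [uIcc_of_le zero_le_one]
    exact hψ.continuousOn.comp (by fun_prop) hp
  · exact aestronglyMeasurable_slice hc' hp
  · exact Eventually.of_forall fun σ hσ q hq => (hC q hq σ (hmem σ hσ)).2
  · exact intervalIntegrable_const
  · refine Eventually.of_forall fun σ hσ q hq => ?_
    have h1 : HasFDerivAt ψ (fderiv ℝ ψ (q, σ)) (q, σ) :=
      ((hψ.differentiableOn (by simp)).differentiableAt
        (hV.mem_nhds (hC q hq σ (hmem σ hσ)).1)).hasFDerivAt
    exact h1.comp q (hasFDerivAt_prodMk_left q σ)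

/-- Induction on the order of smoothness. The codomain is quantified inside the statement because
the step applies the hypothesis to the derivative of the integrand, whose values lie in `E →L[ℝ] F`.
-/
theorem contDiffOn_parametric_integral_nat (n : ℕ) : ∀ {F : Type} [NormedAddCommGroup F]
    [NormedSpace ℝ F] {V : Set (E × ℝ)} (_ : IsOpen V)
    {ψ : E × ℝ → F} (_ : ContDiffOn ℝ n ψ V) {Ω : Set E} (_ : IsOpen Ω)
    (_ : ∀ p ∈ Ω, ∀ σ ∈ Icc (0 : ℝ) 1, (p, σ) ∈ V),
    ContDiffOn ℝ n (fun p => ∫ σ in (0 : ℝ)..1, ψ (p, σ)) Ω := by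
  induction n with
  | zero =>
    intro F _ _ V hV ψ hψ Ω _ hΩV
    simp only [Nat.cast_zero, contDiffOn_zero] at hψ ⊢
    exact continuousOn_parametric_integral hV hψ hΩV
  | succ n ih =>
    intro F _ _ V hV ψ hψ Ω hΩ hΩV
    have h1 : ContDiffOn ℝ 1 ψ V := hψ.of_le (by simp)
    have hfd : ∀ p ∈ Ω, HasFDerivAt (fun p => ∫ σ in (0 : ℝ)..1, ψ (p, σ))
      (∫ σ in (0 : ℝ)..1, (fderiv ℝ ψ (p, σ)).comp (ContinuousLinearMap.inl ℝ E ℝ)) p :=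
      fun p hp => hasFDerivAt_parametric_integral hV h1 (hΩV p hp)
    push_cast
    rw [contDiffOn_succ_iff_fderiv_of_isOpen hΩ]
    refine ⟨fun p hp => (hfd p hp).differentiableAt.differentiableWithinAt, by simp, ?_⟩
    have h2 : ContDiffOn ℝ n
        (fun z => (fderiv ℝ ψ z).comp (ContinuousLinearMap.inl ℝ E ℝ)) V :=
      (hψ.fderiv_of_isOpen hV (by simp)).clm_comp contDiffOn_const
    exact (ih hV h2 hΩ hΩV).congr fun p hp => (hfd p hp).fderiv


/-- The primitive in the second variable, based at `0`, of a smooth function on an open set which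
is star-shaped in the second variable is smooth in both variables. -/
theorem contDiffOn_primitive_snd {Ω : Set (ℝ × ℝ)} (hΩ : IsOpen Ω)
    (hstar : ∀ z ∈ Ω, ∀ σ ∈ Icc (0 : ℝ) 1, (z.1, σ * z.2) ∈ Ω) {φ : ℝ × ℝ → ℝ}
    (hφ : ContDiffOn ℝ ∞ φ Ω) :
    ContDiffOn ℝ ∞ (fun z : ℝ × ℝ => ∫ s in (0 : ℝ)..z.2, φ (z.1, s)) Ω := by
  -- The substitution s = σ t moves the variable endpoint into the integrand, which leaves an
  -- integral over the fixed interval [0,1].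
  have key : (fun z : ℝ × ℝ => ∫ s in (0 : ℝ)..z.2, φ (z.1, s)) =
      fun z : ℝ × ℝ => z.2 * ∫ σ in (0 : ℝ)..1, φ (z.1, σ * z.2) := by
    funext z
    have := intervalIntegral.smul_integral_comp_mul_right (fun s => φ (z.1, s)) (a := 0) (b := 1) z.2
    simpa using this.symm
  rw [key]
  apply contDiffOn_snd.mul
  rw [contDiffOn_infty]
  intro n
  have hcont : Continuous (fun q : (ℝ × ℝ) × ℝ => (q.1.1, q.2 * q.1.2)) := by fun_prop
  have hmap : ContDiff ℝ n (fun q : (ℝ × ℝ) × ℝ => (q.1.1, q.2 * q.1.2)) := by fun_prop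
  exact contDiffOn_parametric_integral_nat n (hΩ.preimage hcont)
    (ψ := fun q : (ℝ × ℝ) × ℝ => φ (q.1.1, q.2 * q.1.2))
    ((hφ.of_le (by exact_mod_cast le_top)).comp hmap.contDiffOn fun q hq => hq) hΩ hstar

theorem hasDerivAt_primitive_snd {Ω : Set (ℝ × ℝ)} (hΩ : IsOpen Ω)
    (hstar : ∀ z ∈ Ω, ∀ σ ∈ Icc (0 : ℝ) 1, (z.1, σ * z.2) ∈ Ω) {φ : ℝ × ℝ → ℝ}
    (hφ : ContinuousOn φ Ω) {c t : ℝ} (hz : (c, t) ∈ Ω) :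
    HasDerivAt (fun t => ∫ s in (0 : ℝ)..t, φ (c, s)) (φ (c, t)) t := by
  have hseg : ∀ s ∈ uIcc 0 t, (c, s) ∈ Ω := by
    intro s hs
    rw [← segment_eq_uIcc, segment_eq_image] at hs
    obtain ⟨σ, hσ, rfl⟩ := hs
    simpa using hstar _ hz σ hσ
  have hnhds : {s | (c, s) ∈ Ω} ∈ 𝓝 t := by
    have : Continuous (fun s : ℝ => (c, s)) := by fun_prop
    exact (hΩ.preimage this).mem_nhds hz
  have hcont : ContinuousOn (fun s => φ (c, s)) {s | (c, s) ∈ Ω} :=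
    hφ.comp (by fun_prop) fun s hs => hs
  have hopen : IsOpen {s : ℝ | (c, s) ∈ Ω} := hΩ.preimage (by fun_prop)
  exact intervalIntegral.integral_hasDerivAt_right
    (hcont.mono hseg).intervalIntegrable
    (hcont.stronglyMeasurableAtFilter hopen t hz)
    (hcont.continuousAt hnhds)

end ParametricIntegral

/-! ### Explicit characteristics of the transport equation. -/

section Transport

open Set Filter Topology MeasureTheory

/-- The linear transport equation with coefficients `β`, `γ`, `δ` depending on time, at `(x, t)`. -/
def SolvesTransportAt (β γ δ : ℝ → ℝ) (n : ℝ) (m : ℕ) (G : ℝ × ℝ → ℝ) (x t : ℝ) : Prop :=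
  partialT G x t = (x - 1) * ((x - 1) * β t + γ t) * partialX G x t
    + ((x - 1) * δ t - n) * G (x, t) + n * x ^ m

theorem HasFDerivAt.partialX_eq {G : ℝ × ℝ → ℝ} {G' : ℝ × ℝ →L[ℝ] ℝ} {x t : ℝ}
    (h : HasFDerivAt G G' (x, t)) : partialX G x t = G' (1, 0) :=
  (h.comp_hasDerivAt x ((hasDerivAt_id x).prodMk (hasDerivAt_const x t))).deriv

theorem HasFDerivAt.partialT_eq {G : ℝ × ℝ → ℝ} {G' : ℝ × ℝ →L[ℝ] ℝ} {x t : ℝ}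
    (h : HasFDerivAt G G' (x, t)) : partialT G x t = G' (0, 1) :=
  (h.comp_hasDerivAt t ((hasDerivAt_const t x).prodMk (hasDerivAt_id t))).deriv

/-- The primitive of a smooth function is smooth. -/
theorem contDiff_primitive {f : ℝ → ℝ} (hf : ContDiff ℝ ∞ f) :
    ContDiff ℝ ∞ (fun t => ∫ s in (0 : ℝ)..t, f s) := by
  rw [contDiff_infty_iff_deriv]
  have h : ∀ t, HasDerivAt (fun t => ∫ s in (0 : ℝ)..t, f s) (f t) t := fun t =>
    hf.continuous.integral_hasStrictDerivAt 0 t |>.hasDerivAt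
  refine ⟨fun t => (h t).differentiableAt, ?_⟩
  rwa [show deriv (fun t => ∫ s in (0 : ℝ)..t, f s) = f from funext fun t => (h t).deriv]

/-- The reciprocal of the growth factor of the linearised characteristics. -/
noncomputable def charK (γ : ℝ → ℝ) (t : ℝ) : ℝ := Real.exp (-∫ s in (0 : ℝ)..t, γ s)

/-- The nonlinear part of the characteristics. -/
noncomputable def charI (β γ : ℝ → ℝ) (t : ℝ) : ℝ := ∫ s in (0 : ℝ)..t, β s * charK γ s

/-- The characteristic, relative to `x = 1`, that starts at `1 + c`. -/
noncomputable def charY (β γ : ℝ → ℝ) (c t : ℝ) : ℝ := c * charK γ t / (1 + c * charI β γ t)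

/-- The denominator of the starting point of the characteristic through `(x, t)`. -/
noncomputable def charL (β γ : ℝ → ℝ) (x t : ℝ) : ℝ := charK γ t - (x - 1) * charI β γ t

variable {β γ δ : ℝ → ℝ}

theorem charK_pos (t : ℝ) : 0 < charK γ t := Real.exp_pos _

@[simp] theorem charK_zero : charK γ 0 = 1 := by simp [charK]

@[simp] theorem charI_zero : charI β γ 0 = 0 := by simp [charI]

theorem contDiff_charK (hγ : ContDiff ℝ ∞ γ) : ContDiff ℝ ∞ (charK γ) :=
  Real.contDiff_exp.comp (contDiff_primitive hγ).neg

theorem contDiff_charI (hβ : ContDiff ℝ ∞ β) (hγ : ContDiff ℝ ∞ γ) :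
    ContDiff ℝ ∞ (charI β γ) :=
  contDiff_primitive (hβ.mul (contDiff_charK hγ))

theorem hasDerivAt_charK (hγ : Continuous γ) (t : ℝ) :
    HasDerivAt (charK γ) (-γ t * charK γ t) t := by
  have := ((hγ.integral_hasStrictDerivAt 0 t).hasDerivAt.neg).exp
  refine this.congr_deriv ?_
  simp only [charK, Pi.neg_apply]
  ring

theorem continuous_charK (hγ : Continuous γ) : Continuous (charK γ) :=
  continuous_iff_continuousAt.2 fun t => (hasDerivAt_charK hγ t).continuousAt

theorem hasDerivAt_charI (hβ : Continuous β) (hγ : Continuous γ) (t : ℝ) :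
    HasDerivAt (charI β γ) (β t * charK γ t) t :=
  ((hβ.mul (continuous_charK hγ)).integral_hasStrictDerivAt 0 t).hasDerivAt

theorem monotone_charI (hβ : Continuous β) (hγ : Continuous γ) (hβ0 : ∀ t, 0 ≤ β t) :
    Monotone (charI β γ) :=
  monotone_of_hasDerivAt_nonneg (fun t => hasDerivAt_charI hβ hγ t)
    fun t => mul_nonneg (hβ0 t) (charK_pos t).le

/-- The equation Y' = -Y(βY+γ) is of Bernoulli type: (1/Y)' = γ/Y + β is linear, whence the
fractional linear dependence on c. -/
theorem hasDerivAt_charY (hβ : Continuous β) (hγ : Continuous γ) {c t : ℝ}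
    (h : 1 + c * charI β γ t ≠ 0) :
    HasDerivAt (charY β γ c)
      (-(charY β γ c t * (charY β γ c t * β t + γ t))) t := by
  have := ((hasDerivAt_charK hγ t).const_mul c).div
    (((hasDerivAt_charI hβ hγ t).const_mul c).const_add 1) h
  refine this.congr_deriv ?_
  simp only [charY]
  field_simp
  ring

/-- The set of `(c, t)` such that the characteristic from `1 + c ∈ (-R, R)` exists up to `t`. -/
def charDomain (β γ : ℝ → ℝ) (R : ℝ) : Set (ℝ × ℝ) :=
  {z | 0 < 1 + z.1 * charI β γ z.2 ∧ |1 + z.1| < R}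

theorem isOpen_charDomain (hβ : Continuous β) (hγ : Continuous γ) (R : ℝ) :
    IsOpen (charDomain β γ R) := by
  have hI : Continuous (charI β γ) :=
    continuous_iff_continuousAt.2 fun t => (hasDerivAt_charI hβ hγ t).continuousAt
  apply IsOpen.and
  · exact isOpen_lt continuous_const (by fun_prop)
  · exact isOpen_lt (by fun_prop) continuous_const

/-- Since β ≥ 0, `charI` is monotone, so 1 + c I moves monotonically from 1 at time 0 to its value
at time t and stays positive in between. This provides the star shape needed for primitives in time.
-/
theorem one_add_mul_charI_pos (hβ : Continuous β) (hγ : Continuous γ) (hβ0 : ∀ t, 0 ≤ β t)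
    {c t σ : ℝ} (h : 0 < 1 + c * charI β γ t) (hσ : σ ∈ Icc (0 : ℝ) 1) :
    0 < 1 + c * charI β γ (σ * t) := by
  have hmono := monotone_charI hβ hγ hβ0
  have h0 : charI β γ 0 = 0 := charI_zero
  rcases le_total 0 t with ht | ht
  · have h1 : charI β γ 0 ≤ charI β γ (σ * t) := hmono (mul_nonneg hσ.1 ht)
    have h2 : charI β γ (σ * t) ≤ charI β γ t := hmono (by nlinarith [hσ.2])
    rcases le_total 0 c with hc | hc <;> nlinarith
  · have h1 : charI β γ (σ * t) ≤ charI β γ 0 := hmono (mul_nonpos_of_nonneg_of_nonpos hσ.1 ht)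
    have h2 : charI β γ t ≤ charI β γ (σ * t) := hmono (by nlinarith [hσ.2])
    rcases le_total 0 c with hc | hc <;> nlinarith

theorem charDomain_star (hβ : Continuous β) (hγ : Continuous γ) (hβ0 : ∀ t, 0 ≤ β t) (R : ℝ) :
    ∀ z ∈ charDomain β γ R, ∀ σ ∈ Icc (0 : ℝ) 1, (z.1, σ * z.2) ∈ charDomain β γ R :=
  fun _ hz _ hσ => ⟨one_add_mul_charI_pos hβ hγ hβ0 hz.1 hσ, hz.2⟩

theorem contDiffOn_charY (hβ : ContDiff ℝ ∞ β) (hγ : ContDiff ℝ ∞ γ) (R : ℝ) :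
    ContDiffOn ℝ ∞ (fun z : ℝ × ℝ => charY β γ z.1 z.2) (charDomain β γ R) := by
  have hK := contDiff_charK hγ
  have hI := contDiff_charI hβ hγ
  apply ContDiffOn.div
  · exact (contDiff_fst.mul (hK.comp contDiff_snd)).contDiffOn
  · exact (contDiff_const.add (contDiff_fst.mul (hI.comp contDiff_snd))).contDiffOn
  · exact fun z hz => hz.1.ne'

/-- The logarithmic growth of solutions along characteristics. -/
noncomputable def charB (β γ δ : ℝ → ℝ) (n c t : ℝ) : ℝ :=
  ∫ s in (0 : ℝ)..t, (charY β γ c s * δ s - n)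

/-- The solution of the transport equation along characteristics. -/
noncomputable def charW (β γ δ : ℝ → ℝ) (n : ℝ) (m : ℕ) (h : ℝ → ℝ) (c t : ℝ) : ℝ :=
  Real.exp (charB β γ δ n c t) * (h (1 + c) +
    n * ∫ s in (0 : ℝ)..t, (1 + charY β γ c s) ^ m * Real.exp (-charB β γ δ n c s))

section

variable (hβ : ContDiff ℝ ∞ β) (hγ : ContDiff ℝ ∞ γ) (hδ : ContDiff ℝ ∞ δ)
  (hβ0 : ∀ t, 0 ≤ β t) (n : ℝ) (m : ℕ) {R : ℝ}
include hβ hγ hδ hβ0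

omit hβ0 in
theorem contDiffOn_charB_integrand :
    ContDiffOn ℝ ∞ (fun z : ℝ × ℝ => charY β γ z.1 z.2 * δ z.2 - n) (charDomain β γ R) :=
  ((contDiffOn_charY hβ hγ R).mul (hδ.comp contDiff_snd).contDiffOn).sub contDiffOn_const

theorem contDiffOn_charB :
    ContDiffOn ℝ ∞ (fun z : ℝ × ℝ => charB β γ δ n z.1 z.2) (charDomain β γ R) :=
  contDiffOn_primitive_snd (isOpen_charDomain hβ.continuous hγ.continuous R)
    (charDomain_star hβ.continuous hγ.continuous hβ0 R)
    (contDiffOn_charB_integrand hβ hγ hδ n)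

theorem contDiffOn_charW_integrand :
    ContDiffOn ℝ ∞ (fun z : ℝ × ℝ =>
      (1 + charY β γ z.1 z.2) ^ m * Real.exp (-charB β γ δ n z.1 z.2)) (charDomain β γ R) :=
  ((contDiffOn_const.add (contDiffOn_charY hβ hγ R)).pow m).mul
    (contDiffOn_charB hβ hγ hδ hβ0 n).neg.exp

theorem contDiffOn_charW {h : ℝ → ℝ} (hh : ContDiffOn ℝ ∞ h (Ioo (-R) R)) :
    ContDiffOn ℝ ∞ (fun z : ℝ × ℝ => charW β γ δ n m h z.1 z.2) (charDomain β γ R) := by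
  refine (contDiffOn_charB hβ hγ hδ hβ0 n).exp.mul (ContDiffOn.add ?_ (contDiffOn_const.mul ?_))
  · exact hh.comp (contDiff_const.add contDiff_fst).contDiffOn fun z hz => abs_lt.1 hz.2
  · exact contDiffOn_primitive_snd (isOpen_charDomain hβ.continuous hγ.continuous R)
      (charDomain_star hβ.continuous hγ.continuous hβ0 R)
      (contDiffOn_charW_integrand hβ hγ hδ hβ0 n m)

theorem hasDerivAt_charW (h : ℝ → ℝ) {c t : ℝ} (hz : (c, t) ∈ charDomain β γ R) :
    HasDerivAt (charW β γ δ n m h c)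
      ((charY β γ c t * δ t - n) * charW β γ δ n m h c t + n * (1 + charY β γ c t) ^ m) t := by
  have hΩ := isOpen_charDomain hβ.continuous hγ.continuous R
  have hstar := charDomain_star hβ.continuous hγ.continuous hβ0 R
  have h1 := (hasDerivAt_primitive_snd hΩ hstar
    (contDiffOn_charB_integrand hβ hγ hδ n).continuousOn hz).exp
  have h2 := hasDerivAt_primitive_snd hΩ hstar
    (contDiffOn_charW_integrand hβ hγ hδ hβ0 n m).continuousOn hz
  have h3 := h1.mul ((h2.const_mul n).const_add (h (1 + c)))
  refine h3.congr_deriv ?_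
  simp only [charW, charB, Real.exp_neg]
  field_simp

end

end Transport

/-! ### Solution of the transport equation and its uniqueness. -/

section TransportSolution

open Set Filter Topology MeasureTheory

variable {β γ δ : ℝ → ℝ}

/-- The set of points reached by the characteristics that start in `(-R, R)`. -/
def transportDomain (β γ : ℝ → ℝ) (R : ℝ) : Set (ℝ × ℝ) :=
  {z | 0 < charL β γ z.1 z.2 ∧ |charL β γ z.1 z.2 + (z.1 - 1)| < R * charL β γ z.1 z.2}

/-- The starting point, relative to `x = 1`, of the characteristic through `(x, t)`. -/
noncomputable def charStart (β γ : ℝ → ℝ) (z : ℝ × ℝ) : ℝ := (z.1 - 1) / charL β γ z.1 z.2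

/-- The solution of the transport equation with initial values `h`. -/
noncomputable def transportSol (β γ δ : ℝ → ℝ) (n : ℝ) (m : ℕ) (h : ℝ → ℝ) (z : ℝ × ℝ) : ℝ :=
  charW β γ δ n m h (charStart β γ z) z.2

theorem transportDomain_mono {R R' : ℝ} (h : R ≤ R') :
    transportDomain β γ R ⊆ transportDomain β γ R' :=
  fun _ hz => ⟨hz.1, hz.2.trans_le (mul_le_mul_of_nonneg_right h hz.1.le)⟩

theorem one_add_charStart_mul_charI {z : ℝ × ℝ} (hz : 0 < charL β γ z.1 z.2) :
    1 + charStart β γ z * charI β γ z.2 = charK γ z.2 / charL β γ z.1 z.2 := by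
  have : charK γ z.2 = charL β γ z.1 z.2 + (z.1 - 1) * charI β γ z.2 := by
    simp only [charL]; ring
  rw [this, charStart]
  field_simp

theorem charStart_mem {R : ℝ} {z : ℝ × ℝ} (hz : z ∈ transportDomain β γ R) :
    (charStart β γ z, z.2) ∈ charDomain β γ R := by
  refine ⟨?_, ?_⟩
  · simp only [one_add_charStart_mul_charI hz.1]
    exact div_pos (charK_pos _) hz.1
  · have h1 : 1 + charStart β γ z = (charL β γ z.1 z.2 + (z.1 - 1)) / charL β γ z.1 z.2 := by
      rw [charStart, add_div, div_self hz.1.ne']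
    simp only [h1, abs_div, abs_of_pos hz.1]
    rw [div_lt_iff₀ hz.1]
    exact hz.2

/-- Solving x - 1 = cK/(1 + cI) for c gives c = (x-1)/(K - (x-1)I), which is `charStart`. -/
theorem charY_charStart {z : ℝ × ℝ} (hz : 0 < charL β γ z.1 z.2) :
    charY β γ (charStart β γ z) z.2 = z.1 - 1 := by
  have hK := charK_pos (γ := γ) z.2
  rw [charY, one_add_charStart_mul_charI hz, charStart]
  field_simp

theorem charL_charY {c t : ℝ} (h : 0 < 1 + c * charI β γ t) :
    charL β γ (1 + charY β γ c t) t = charK γ t / (1 + c * charI β γ t) := by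
  simp only [charL, charY]
  field_simp
  ring

theorem charY_mem_transportDomain {R c t : ℝ} (h : (c, t) ∈ charDomain β γ R) :
    (1 + charY β γ c t, t) ∈ transportDomain β γ R := by
  obtain ⟨h1, h2⟩ := h
  simp only at h1 h2
  have hK := charK_pos (γ := γ) t
  have hL := charL_charY h1
  have hpos : 0 < charK γ t / (1 + c * charI β γ t) := div_pos hK h1
  refine ⟨by simpa only [hL], ?_⟩
  simp only [hL]
  have h3 : charK γ t / (1 + c * charI β γ t) + (1 + charY β γ c t - 1)
      = (1 + c) * (charK γ t / (1 + c * charI β γ t)) := by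
    simp only [charY]; ring
  rw [h3, abs_mul, abs_of_pos hpos]
  exact mul_lt_mul_of_pos_right h2 hpos

theorem contDiff_charL (hβ : ContDiff ℝ ∞ β) (hγ : ContDiff ℝ ∞ γ) :
    ContDiff ℝ ∞ (fun z : ℝ × ℝ => charL β γ z.1 z.2) :=
  ((contDiff_charK hγ).comp contDiff_snd).sub
    ((contDiff_fst.sub contDiff_const).mul ((contDiff_charI hβ hγ).comp contDiff_snd))

theorem isOpen_transportDomain (hβ : ContDiff ℝ ∞ β) (hγ : ContDiff ℝ ∞ γ) (R : ℝ) :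
    IsOpen (transportDomain β γ R) := by
  have hL := (contDiff_charL hβ hγ).continuous
  apply IsOpen.and
  · exact isOpen_lt continuous_const hL
  · exact isOpen_lt (hL.add (by fun_prop)).abs (hL.const_mul R)

theorem contDiffOn_charStart (hβ : ContDiff ℝ ∞ β) (hγ : ContDiff ℝ ∞ γ) (R : ℝ) :
    ContDiffOn ℝ ∞ (charStart β γ) (transportDomain β γ R) :=
  (contDiff_fst.sub contDiff_const).contDiffOn.div (contDiff_charL hβ hγ).contDiffOn
    fun _ hz => hz.1.ne'

theorem contDiffOn_transportSol (hβ : ContDiff ℝ ∞ β) (hγ : ContDiff ℝ ∞ γ)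
    (hδ : ContDiff ℝ ∞ δ) (hβ0 : ∀ t, 0 ≤ β t) (n : ℝ) (m : ℕ) {R : ℝ} {h : ℝ → ℝ}
    (hh : ContDiffOn ℝ ∞ h (Ioo (-R) R)) :
    ContDiffOn ℝ ∞ (transportSol β γ δ n m h) (transportDomain β γ R) :=
  (contDiffOn_charW hβ hγ hδ hβ0 n m hh).comp
    ((contDiffOn_charStart hβ hγ R).prodMk contDiffOn_snd) fun _ hz => charStart_mem hz

theorem transportSol_zero (n : ℝ) (m : ℕ) (h : ℝ → ℝ) (x : ℝ) :
    transportSol β γ δ n m h (x, 0) = h x := by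
  simp [transportSol, charW, charStart, charL, charB]

/-- Chain rule for W(c(x,t),t). The starting point c is constant along characteristics, that is, c_t
is the transport field times c_x, so the terms in W_c give the transport term. The derivative W_t
gives growth and source. -/
theorem solvesTransportAt_transportSol (hβ : ContDiff ℝ ∞ β) (hγ : ContDiff ℝ ∞ γ)
    (hδ : ContDiff ℝ ∞ δ) (hβ0 : ∀ t, 0 ≤ β t) (n : ℝ) (m : ℕ) {R : ℝ} {h : ℝ → ℝ}
    (hh : ContDiffOn ℝ ∞ h (Ioo (-R) R)) {x t : ℝ} (hz : (x, t) ∈ transportDomain β γ R) :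
    SolvesTransportAt β γ δ n m (transportSol β γ δ n m h) x t := by
  have hc := charStart_mem hz
  set c := charStart β γ (x, t) with hcdef
  have hL0 : 0 < charL β γ x t := hz.1
  have hW : HasFDerivAt (fun z : ℝ × ℝ => charW β γ δ n m h z.1 z.2)
      (fderiv ℝ (fun z : ℝ × ℝ => charW β γ δ n m h z.1 z.2) (c, t)) (c, t) :=
    (((contDiffOn_charW hβ hγ hδ hβ0 n m hh).differentiableOn (by simp)).differentiableAt
      ((isOpen_charDomain hβ.continuous hγ.continuous R).mem_nhds hc)).hasFDerivAt
  set W' := fderiv ℝ (fun z : ℝ × ℝ => charW β γ δ n m h z.1 z.2) (c, t)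
  have hWt : W' (0, 1) =
      (charY β γ c t * δ t - n) * charW β γ δ n m h c t + n * (1 + charY β γ c t) ^ m := by
    have h1 := hasDerivAt_charW hβ hγ hδ hβ0 n m h hc
    have h2 := hW.comp_hasDerivAt t ((hasDerivAt_const t c).prodMk (hasDerivAt_id t))
    exact h2.unique h1
  have hY : charY β γ c t = x - 1 := charY_charStart hz.1
  have hlin : ∀ a b : ℝ, W' (a, b) = a * W' (1, 0) + b * W' (0, 1) := by
    intro a b
    have : ((a, b) : ℝ × ℝ) = a • ((1, 0) : ℝ × ℝ) + b • ((0, 1) : ℝ × ℝ) := by simp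
    rw [this, map_add, map_smul, map_smul]; simp
  have hIt := hasDerivAt_charI hβ.continuous hγ.continuous t
  have hKt := hasDerivAt_charK hγ.continuous t
  have hLx : HasDerivAt (fun y => charL β γ y t) (-charI β γ t) x := by
    have := (((hasDerivAt_id x).sub_const 1).mul_const (charI β γ t)).const_sub (charK γ t)
    exact this.congr_deriv (by simp)
  have hLt : HasDerivAt (fun s => charL β γ x s)
      (-γ t * charK γ t - (x - 1) * (β t * charK γ t)) t := hKt.sub (hIt.const_mul (x - 1))
  have hcx : HasDerivAt (fun y => charStart β γ (y, t)) (charK γ t / charL β γ x t ^ 2) x := by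
    refine (((hasDerivAt_id x).sub_const 1).div hLx hL0.ne').congr_deriv ?_
    simp only [id, charL]
    ring
  have hct : HasDerivAt (fun s => charStart β γ (x, s))
      ((x - 1) * ((x - 1) * β t + γ t) * (charK γ t / charL β γ x t ^ 2)) t := by
    refine ((hasDerivAt_const t (x - 1)).div hLt hL0.ne').congr_deriv ?_
    ring
  have hGx : partialX (transportSol β γ δ n m h) x t =
      charK γ t / charL β γ x t ^ 2 * W' (1, 0) := by
    have h2 := HasFDerivAt.comp_hasDerivAt x hW (hcx.prodMk (hasDerivAt_const x t))
    have h3 : partialX (transportSol β γ δ n m h) x t = _ := h2.deriv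
    rw [h3, hlin]; ring
  have hGt : partialT (transportSol β γ δ n m h) x t =
      (x - 1) * ((x - 1) * β t + γ t) * (charK γ t / charL β γ x t ^ 2) * W' (1, 0)
        + W' (0, 1) := by
    have h2 := HasFDerivAt.comp_hasDerivAt (f := fun s => (charStart β γ (x, s), s)) t hW (hct.prodMk (hasDerivAt_id t))
    have h3 : partialT (transportSol β γ δ n m h) x t = _ := h2.deriv
    rw [h3, hlin]; ring
  have hG : transportSol β γ δ n m h (x, t) = charW β γ δ n m h c t := rfl
  rw [SolvesTransportAt, hGt, hGx, hWt, hY, hG, add_sub_cancel]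
  ring

/-- The derivative is (2β-γ)K ≥ 0. The quantity is L = `charL` at x = -1, so the bound says that the
characteristic through x = -1 starts at 1 - 2/L ≥ -1. -/
theorem one_le_charK_add_two_mul_charI (hβ : Continuous β) (hγ : Continuous γ)
    (hβ0 : ∀ t, 0 ≤ β t) (hγβ : ∀ t, γ t ≤ β t) {t : ℝ} (ht : 0 ≤ t) :
    1 ≤ charK γ t + 2 * charI β γ t := by
  have hmono : Monotone (fun t => charK γ t + 2 * charI β γ t) := by
    refine monotone_of_hasDerivAt_nonneg
      (fun t => (hasDerivAt_charK hγ t).add ((hasDerivAt_charI hβ hγ t).const_mul 2)) fun t => ?_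
    have := charK_pos (γ := γ) t
    simp only [Pi.zero_apply]
    nlinarith [hβ0 t, hγβ t, mul_nonneg (hβ0 t) this.le,
      mul_nonneg (sub_nonneg.2 (hγβ t)) this.le]
  simpa using hmono ht

theorem mem_transportDomain (hβ : Continuous β) (hγ : Continuous γ)
    (hβ0 : ∀ t, 0 ≤ β t) (hγβ : ∀ t, γ t ≤ β t) {R : ℝ} (hR : 1 < R) {x t : ℝ}
    (hx : x ∈ Icc (-1 : ℝ) 1) (ht : 0 ≤ t) : (x, t) ∈ transportDomain β γ R := by
  have hK := charK_pos (γ := γ) t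
  have hI : 0 ≤ charI β γ t := by simpa using monotone_charI hβ hγ hβ0 ht
  have h1 := one_le_charK_add_two_mul_charI hβ hγ hβ0 hγβ ht
  have hL : 0 < charL β γ x t := by
    simp only [charL]; nlinarith [hx.2, mul_nonneg (sub_nonneg.2 hx.2) hI]
  refine ⟨hL, ?_⟩
  simp only
  -- Equivalently, the starting point 1 + (x-1)/L lies in [-1,1]; R > 1 then makes the required
  -- inequality strict.
  have h2 : |charL β γ x t + (x - 1)| ≤ charL β γ x t := by
    rw [abs_le]
    refine ⟨?_, by linarith [hx.2]⟩
    simp only [charL]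
    nlinarith [hx.1, hx.2, mul_nonneg (sub_nonneg.2 hx.2) (sub_nonneg.2 h1)]
  nlinarith

/-- A solution of the transport equation satisfies a linear equation along characteristics. -/
theorem SolvesTransportAt.hasDerivAt_comp {n : ℝ} {m : ℕ} {F : ℝ × ℝ → ℝ} {Y : ℝ → ℝ} {s : ℝ}
    (hF : DifferentiableAt ℝ F (1 + Y s, s)) (hs : SolvesTransportAt β γ δ n m F (1 + Y s) s)
    (hY : HasDerivAt Y (-(Y s * (Y s * β s + γ s))) s) :
    HasDerivAt (fun s => F (1 + Y s, s)) ((Y s * δ s - n) * F (1 + Y s, s) + n * (1 + Y s) ^ m)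
      s := by
  have h := hF.hasFDerivAt
  set F' := fderiv ℝ F (1 + Y s, s)
  have hlin : ∀ a b : ℝ, F' (a, b) = a * F' (1, 0) + b * F' (0, 1) := by
    intro a b
    have : ((a, b) : ℝ × ℝ) = a • ((1, 0) : ℝ × ℝ) + b • ((0, 1) : ℝ × ℝ) := by simp
    rw [this, map_add, map_smul, map_smul]; simp
  rw [SolvesTransportAt, h.partialX_eq, h.partialT_eq] at hs
  refine (HasFDerivAt.comp_hasDerivAt (f := fun s => (1 + Y s, s)) s h
    ((hY.const_add 1).prodMk (hasDerivAt_id s))).congr_deriv ?_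
  rw [hlin, hs]
  ring

/-- Uniqueness for a homogeneous linear differential inequality with initial value zero. -/
theorem eq_zero_of_abs_deriv_le {e e' : ℝ → ℝ} {a b C : ℝ} (hab : a ≤ b)
    (hc : ContinuousOn e (Icc a b)) (ha : e a = 0) (hd : ∀ s ∈ Ioo a b, HasDerivAt e (e' s) s)
    (hb : ∀ s ∈ Ioo a b, |e' s| ≤ C * |e s|) : e b = 0 := by
  -- The weight exp(-2Cs) compensates the growth (e²)' = 2ee' ≤ 2Ce².
  have hanti : AntitoneOn (fun s => e s ^ 2 * Real.exp (-(2 * C * s))) (Icc a b) := by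
    have hder : ∀ s ∈ Ioo a b, HasDerivAt (fun s => e s ^ 2 * Real.exp (-(2 * C * s)))
        ((2 * (e s * e' s) - 2 * C * e s ^ 2) * Real.exp (-(2 * C * s))) s := by
      intro s hs
      have h1 := ((hd s hs).pow 2).mul ((((hasDerivAt_id s).const_mul (2 * C)).neg).exp)
      refine h1.congr_deriv ?_
      simp
      ring
    apply antitoneOn_of_deriv_nonpos (convex_Icc a b)
    · exact (hc.pow 2).mul (by fun_prop)
    · rw [interior_Icc]
      exact fun s hs => (hder s hs).differentiableAt.differentiableWithinAt
    · rw [interior_Icc]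
      intro s hs
      rw [(hder s hs).deriv]
      apply mul_nonpos_of_nonpos_of_nonneg _ (Real.exp_pos _).le
      have h1 : e s * e' s ≤ |e s| * |e' s| := by rw [← abs_mul]; exact le_abs_self _
      have h2 := mul_le_mul_of_nonneg_left (hb s hs) (abs_nonneg (e s))
      have h3 : |e s| * (C * |e s|) = C * e s ^ 2 := by rw [← sq_abs (e s)]; ring
      linarith
  have h := hanti (left_mem_Icc.2 hab) (right_mem_Icc.2 hab) hab
  simp only [ha] at h
  have h2 : e b ^ 2 ≤ 0 := by
    by_contra hcon
    push Not at hcon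
    have := mul_pos hcon (Real.exp_pos (-(2 * C * b)))
    norm_num at h
    linarith
  nlinarith [sq_nonneg (e b)]

/-- Uniqueness for the initial value problem of the transport equation. -/
theorem transport_unique (hβ : ContDiff ℝ ∞ β) (hγ : ContDiff ℝ ∞ γ)
    (hδ : ContDiff ℝ ∞ δ) (hβ0 : ∀ t, 0 ≤ β t) {n : ℝ} {m : ℕ} {R : ℝ} {F G : ℝ × ℝ → ℝ}
    {D : Set (ℝ × ℝ)} (hD : D = transportDomain β γ R ∩ {z | 0 < z.2})
    (hF : DifferentiableOn ℝ F D) (hG : DifferentiableOn ℝ G D)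
    (hFs : ∀ x t, (x, t) ∈ D → SolvesTransportAt β γ δ n m F x t)
    (hGs : ∀ x t, (x, t) ∈ D → SolvesTransportAt β γ δ n m G x t)
    (hFc : ContinuousOn F (D ∪ initialBoundary D)) (hGc : ContinuousOn G (D ∪ initialBoundary D))
    (h0 : ∀ x, (x, (0 : ℝ)) ∈ frontier D → F (x, 0) = G (x, 0)) : EqOn F G D := by
  have hDo : IsOpen D := by
    rw [hD]
    exact (isOpen_transportDomain hβ hγ R).inter (isOpen_lt continuous_const continuous_snd)
  rintro ⟨x, t⟩ hz
  have hz' := hz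
  rw [hD] at hz'
  obtain ⟨hzT, ht⟩ := hz'
  replace ht : 0 < t := ht
  have hc := charStart_mem hzT
  set c := charStart β γ (x, t)
  have hstar : ∀ s ∈ Icc 0 t, (c, s) ∈ charDomain β γ R := by
    intro s hs
    have := charDomain_star hβ.continuous hγ.continuous hβ0 R _ hc (s / t)
      ⟨div_nonneg hs.1 ht.le, (div_le_one ht).2 hs.2⟩
    simpa [div_mul_cancel₀ _ ht.ne'] using this
  have hYd : ∀ s ∈ Icc 0 t, HasDerivAt (charY β γ c)
      (-(charY β γ c s * (charY β γ c s * β s + γ s))) s := fun s hs =>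
    hasDerivAt_charY hβ.continuous hγ.continuous (hstar s hs).1.ne'
  have hYc : ContinuousOn (charY β γ c) (Icc 0 t) := fun s hs =>
    (hYd s hs).continuousAt.continuousWithinAt
  have hmemD : ∀ s ∈ Ioc 0 t, (1 + charY β γ c s, s) ∈ D := by
    intro s hs
    rw [hD]
    exact ⟨charY_mem_transportDomain (hstar s ⟨hs.1.le, hs.2⟩), hs.1⟩
  have hcurve : ContinuousOn (fun s => (1 + charY β γ c s, s)) (Icc 0 t) :=
    (continuousOn_const.add hYc).prodMk continuousOn_id
  -- The foot of the characteristic is a limit of its points in D, while D itself contains no point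
  -- with t = 0; so the initial condition applies there.
  have hfr : (1 + charY β γ c 0, (0 : ℝ)) ∈ frontier D := by
    rw [hDo.frontier_eq]
    refine ⟨?_, fun hmem => ?_⟩
    · have h1 : Tendsto (fun s => (1 + charY β γ c s, s)) (𝓝[Ioc 0 t] 0)
          (𝓝 (1 + charY β γ c 0, 0)) :=
        (hcurve 0 (left_mem_Icc.2 ht.le)).mono_left (nhdsWithin_mono _ Ioc_subset_Icc_self)
      have : (𝓝[Ioc 0 t] (0 : ℝ)).NeBot := by
        rw [nhdsWithin_Ioc_eq_nhdsGT ht]; infer_instance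
      exact mem_closure_of_tendsto h1 (eventually_nhdsWithin_of_forall hmemD)
    · rw [hD] at hmem
      exact lt_irrefl (0 : ℝ) hmem.2
  have hmem : ∀ s ∈ Icc 0 t, (1 + charY β γ c s, s) ∈ D ∪ initialBoundary D := by
    intro s hs
    rcases hs.1.eq_or_lt with rfl | h
    · exact Or.inr ⟨hfr, rfl⟩
    · exact Or.inl (hmemD s ⟨h, hs.2⟩)
  obtain ⟨C, hC⟩ := isCompact_Icc.exists_bound_of_continuousOn
    ((hYc.mul hδ.continuous.continuousOn).sub (continuousOn_const (c := n)))
  have hzero := eq_zero_of_abs_deriv_le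
    (e := fun s => F (1 + charY β γ c s, s) - G (1 + charY β γ c s, s))
    (e' := fun s => (charY β γ c s * δ s - n) *
      (F (1 + charY β γ c s, s) - G (1 + charY β γ c s, s))) (C := C) ht.le
    ((hFc.comp hcurve hmem).sub (hGc.comp hcurve hmem)) (by simp [h0 _ hfr])
    (fun s hs => by
      have hs' : s ∈ Ioc 0 t := ⟨hs.1, hs.2.le⟩
      have h1 := SolvesTransportAt.hasDerivAt_comp (hF.differentiableAt (hDo.mem_nhds (hmemD s hs')))
        (hFs _ _ (hmemD s hs')) (hYd s ⟨hs.1.le, hs.2.le⟩)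
      have h2 := SolvesTransportAt.hasDerivAt_comp (hG.differentiableAt (hDo.mem_nhds (hmemD s hs')))
        (hGs _ _ (hmemD s hs')) (hYd s ⟨hs.1.le, hs.2.le⟩)
      exact (h1.sub h2).congr_deriv (by ring))
    (fun s hs => by
      rw [abs_mul]
      exact mul_le_mul_of_nonneg_right (hC s ⟨hs.1.le, hs.2.le⟩) (abs_nonneg _))
  have hYt : 1 + charY β γ c t = x := by
    have := charY_charStart (β := β) (γ := γ) hzT.1
    simp only at this
    linarith
  simp only [hYt] at hzero
  exact sub_eq_zero.1 hzero

end TransportSolution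

/-! ### Global positive solutions of the Riccati equation. -/

section Riccati

open Set Filter Topology

/-- The linear system whose solutions have quotients that solve the Riccati equation
`u' = A - B u - a u ^ 2`. -/
theorem exists_linear_system {A B a u₀ : ℝ} (hA : 0 ≤ A) (hB : 0 ≤ B) (ha : 0 ≤ a)
    (hu : 0 < u₀) : ∃ N M : ℝ → ℝ, ContDiff ℝ ∞ N ∧ ContDiff ℝ ∞ M ∧ N 0 = u₀ ∧ M 0 = 1 ∧
      (∀ t, HasDerivAt N (A * M t - B * N t) t) ∧ (∀ t, HasDerivAt M (a * N t) t) ∧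
      (∀ t, 0 ≤ t → 0 < N t) ∧ (∀ t, 0 ≤ t → 0 < M t) := by
  have hAa : 0 ≤ A * a := mul_nonneg hA ha
  -- The exponents of the linear system are -B/2 ± d with d² = B²/4 + Aa. If d = 0, then B = 0 and
  -- Aa = 0, and the solutions are affine.
  rcases (by positivity : 0 ≤ B ^ 2 / 4 + A * a).eq_or_lt with h0 | hpos
  · have hB0 : B = 0 := by nlinarith [sq_nonneg B]
    have hAa0 : A * a = 0 := by nlinarith [sq_nonneg B]
    subst hB0
    refine ⟨fun t => u₀ + A * t, fun t => 1 + a * u₀ * t, by fun_prop, by fun_prop, by simp,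
      by simp, fun t => ?_, fun t => ?_, fun t ht => by positivity, fun t ht => by positivity⟩
    · refine (((hasDerivAt_id t).const_mul A).const_add u₀).congr_deriv ?_
      linear_combination (-u₀ * t) * hAa0
    · refine (((hasDerivAt_id t).const_mul (a * u₀)).const_add 1).congr_deriv ?_
      linear_combination (-t) * hAa0
  · obtain ⟨d, hd, hd2⟩ : ∃ d : ℝ, 0 < d ∧ d ^ 2 = B ^ 2 / 4 + A * a :=
      ⟨√(B ^ 2 / 4 + A * a), Real.sqrt_pos.2 hpos, Real.sq_sqrt hpos.le⟩
    have hBd : B / 2 ≤ d := by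
      by_contra hcon
      push Not at hcon
      nlinarith
    have hexp : ∀ t : ℝ, HasDerivAt (fun t => Real.exp (-(B / 2 * t)))
        (-(B / 2) * Real.exp (-(B / 2 * t))) t := fun t =>
      (((hasDerivAt_id t).const_mul (B / 2)).neg.exp).congr_deriv (by simp; ring)
    have hcosh : ∀ t : ℝ, HasDerivAt (fun t => Real.cosh (d * t)) (d * Real.sinh (d * t)) t :=
      fun t => (((hasDerivAt_id t).const_mul d).cosh).congr_deriv (by simp; ring)
    have hsinh : ∀ t : ℝ, HasDerivAt (fun t => Real.sinh (d * t)) (d * Real.cosh (d * t)) t :=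
      fun t => (((hasDerivAt_id t).const_mul d).sinh).congr_deriv (by simp; ring)
    have hs0 : ∀ t : ℝ, 0 ≤ t → 0 ≤ Real.sinh (d * t) := fun t ht =>
      Real.sinh_nonneg_iff.2 (by positivity)
    have hcE : ContDiff ℝ ∞ (fun t : ℝ => Real.exp (-(B / 2 * t))) :=
      (contDiff_const.mul contDiff_id).neg.exp
    have hcC : ContDiff ℝ ∞ (fun t : ℝ => Real.cosh (d * t)) :=
      Real.contDiff_cosh.comp (contDiff_const.mul contDiff_id)
    have hcS : ContDiff ℝ ∞ (fun t : ℝ => Real.sinh (d * t)) :=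
      Real.contDiff_sinh.comp (contDiff_const.mul contDiff_id)
    refine ⟨fun t => Real.exp (-(B / 2 * t)) *
        (u₀ * Real.cosh (d * t) + (A - B / 2 * u₀) / d * Real.sinh (d * t)),
      fun t => Real.exp (-(B / 2 * t)) *
        (Real.cosh (d * t) + (a * u₀ + B / 2) / d * Real.sinh (d * t)),
      hcE.mul ((contDiff_const.mul hcC).add (contDiff_const.mul hcS)),
      hcE.mul (hcC.add (contDiff_const.mul hcS)), by simp, by simp, fun t => ?_, fun t => ?_,
      fun t ht => ?_, fun t ht => ?_⟩
    · refine ((hexp t).mul (((hcosh t).const_mul u₀).add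
        ((hsinh t).const_mul ((A - B / 2 * u₀) / d)))).congr_deriv ?_
      simp only [Pi.add_apply]
      field_simp
      linear_combination (u₀ * Real.sinh (t * d)) * hd2 * 4
    · refine ((hexp t).mul ((hcosh t).add
        ((hsinh t).const_mul ((a * u₀ + B / 2) / d)))).congr_deriv ?_
      simp only [Pi.add_apply]
      field_simp
      linear_combination (Real.sinh (t * d)) * hd2 * 4
    · apply mul_pos (Real.exp_pos _)
      have h1 := hs0 t ht
      have h2 : Real.sinh (d * t) < Real.cosh (d * t) := Real.sinh_lt_cosh _
      -- The coefficient A - B u₀/2 may be negative. Splitting off cosh - sinh > 0 leaves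
      -- nonnegative terms because B/2 ≤ d.
      have h3 : u₀ * Real.cosh (d * t) + (A - B / 2 * u₀) / d * Real.sinh (d * t) =
          u₀ * (Real.cosh (d * t) - Real.sinh (d * t)) + A / d * Real.sinh (d * t) +
            u₀ * (d - B / 2) / d * Real.sinh (d * t) := by
        field_simp; ring
      rw [h3]
      have h4 : 0 < u₀ * (Real.cosh (d * t) - Real.sinh (d * t)) := mul_pos hu (by linarith)
      have h5 : 0 ≤ u₀ * (d - B / 2) / d * Real.sinh (d * t) :=
        mul_nonneg (div_nonneg (mul_nonneg hu.le (by linarith)) hd.le) h1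
      positivity
    · apply mul_pos (Real.exp_pos _)
      have h1 := hs0 t ht
      have h2 := Real.cosh_pos (d * t)
      positivity

/-- Global solvability of the Riccati equation with positive initial value; the solution is
extended to negative times as a smooth positive function. -/
theorem exists_riccati {A B a u₀ : ℝ} (hA : 0 ≤ A) (hB : 0 ≤ B) (ha : 0 ≤ a) (hu : 0 < u₀) :
    ∃ u : ℝ → ℝ, ContDiff ℝ ∞ u ∧ (∀ t, 0 < u t) ∧ u 0 = u₀ ∧
      ∀ t, 0 ≤ t → HasDerivAt u (A - B * u t - a * u t ^ 2) t := by
  obtain ⟨N, M, hN, hM, hN0, hM0, hN', hM', hNp, hMp⟩ := exists_linear_system hA hB ha hu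
  obtain ⟨ε, hε, hball⟩ : ∃ ε > 0, ∀ t, -ε < t → 0 < N t ∧ 0 < M t := by
    have h1 : ∀ᶠ t in 𝓝 (0 : ℝ), 0 < N t ∧ 0 < M t :=
      (hN.continuous.continuousAt.eventually (lt_mem_nhds (hNp 0 le_rfl))).and
        (hM.continuous.continuousAt.eventually (lt_mem_nhds (hMp 0 le_rfl)))
    obtain ⟨ε, hε, h⟩ := Metric.eventually_nhds_iff.1 h1
    refine ⟨ε, hε, fun t ht => ?_⟩
    rcases le_or_gt 0 t with h0 | h0
    · exact ⟨hNp t h0, hMp t h0⟩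
    · apply h
      rw [Real.dist_eq, sub_zero, abs_of_neg h0]
      linarith
  -- A cutoff equal to 1 for t ≥ -ε/2 and to 0 for t ≤ -ε. Blending N and M with the constant 1
  -- keeps both positive at all times and changes nothing near t ≥ 0; the transport solution is then
  -- smooth across t = 0.
  set χ : ℝ → ℝ := fun t => Real.smoothTransition (2 + 2 * t / ε) with hχ
  have hχc : ContDiff ℝ ∞ χ := Real.smoothTransition.contDiff.comp (by fun_prop)
  have hχ1 : ∀ t, -ε / 2 ≤ t → χ t = 1 := fun t ht => by
    apply Real.smoothTransition.one_of_one_le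
    have : -1 ≤ 2 * t / ε := by rw [le_div_iff₀ hε]; linarith
    linarith
  have hχ0 : ∀ t, t ≤ -ε → χ t = 0 := fun t ht => by
    apply Real.smoothTransition.zero_of_nonpos
    have : 2 * t / ε ≤ -2 := by rw [div_le_iff₀ hε]; linarith
    linarith
  have hχn : ∀ t, 0 ≤ χ t := fun t => Real.smoothTransition.nonneg _
  have hχl : ∀ t, χ t ≤ 1 := fun t => Real.smoothTransition.le_one _
  have hpos : ∀ (f : ℝ → ℝ), (∀ t, -ε < t → 0 < f t) → ∀ t, 0 < χ t * f t + (1 - χ t) := by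
    intro f hf t
    rcases le_or_gt t (-ε) with h | h
    · simp [hχ0 t h]
    · rcases (hχn t).eq_or_lt with h0 | h0
      · simp [← h0]
      · have := mul_pos h0 (hf t h)
        linarith [hχl t]
  have hNq := hpos N fun t ht => (hball t ht).1
  have hMq := hpos M fun t ht => (hball t ht).2
  refine ⟨fun t => (χ t * N t + (1 - χ t)) / (χ t * M t + (1 - χ t)), ?_,
    fun t => div_pos (hNq t) (hMq t), ?_, fun t ht => ?_⟩
  · exact ((hχc.mul hN).add (contDiff_const.sub hχc)).div
      ((hχc.mul hM).add (contDiff_const.sub hχc)) fun t => (hMq t).ne'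
  · simp [hχ1 0 (by linarith), hN0, hM0]
  · have h1 := (hN' t).div (hM' t) (hMp t ht).ne'
    have h2 : (fun t => (χ t * N t + (1 - χ t)) / (χ t * M t + (1 - χ t))) =ᶠ[𝓝 t] N / M := by
      filter_upwards [lt_mem_nhds (show -ε / 2 < t by linarith)] with s hs
      simp [hχ1 s hs.le]
    refine (h1.congr_of_eventuallyEq h2).congr_deriv ?_
    have := (hMp t ht).ne'
    simp only [hχ1 t (by linarith), one_mul, sub_self, add_zero]
    field_simp

end Riccati

/-! ### The equation for the x-derivative at x = 1. -/

section PartialX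

open Set Filter Topology

/-- The derivative with respect to `x` at `x = 1` of a twice differentiable solution of the
transport equation. -/
theorem hasDerivAt_partialX_one {β γ δ : ℝ → ℝ} {n : ℝ} {m : ℕ} {F : ℝ × ℝ → ℝ} {t : ℝ}
    (hF : ContDiffAt ℝ 2 F (1, t))
    (hs : ∀ᶠ z in 𝓝 ((1 : ℝ), t), SolvesTransportAt β γ δ n m F z.1 z.2) :
    HasDerivAt (partialX F 1) ((γ t - n) * partialX F 1 t + δ t * F (1, t) + n * m) t := by
  have hd : ∀ᶠ z in 𝓝 ((1 : ℝ), t), HasFDerivAt F (fderiv ℝ F z) z := by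
    filter_upwards [hF.eventually (by simp)] with z hz
    exact (hz.differentiableAt (by simp)).hasFDerivAt
  have hF' : HasFDerivAt (fderiv ℝ F) (fderiv ℝ (fderiv ℝ F) (1, t)) (1, t) :=
    ((hF.fderiv_right (m := 1) (by norm_num)).differentiableAt (by simp)).hasFDerivAt
  set S := fderiv ℝ (fderiv ℝ F) (1, t) with hS
  -- Here C² regularity enters: the time derivative of F_x(1,·) is replaced by the x-derivative of
  -- F_t, which the equation expresses.
  have hsymm : S (0, 1) (1, 0) = S (1, 0) (0, 1) :=
    (hF.isSymmSndFDerivAt (by simp)) (0, 1) (1, 0)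
  have hlineT : Tendsto (fun s : ℝ => ((1 : ℝ), s)) (𝓝 t) (𝓝 (1, t)) :=
    (by fun_prop : Continuous fun s : ℝ => ((1 : ℝ), s)).tendsto t
  have hlineX : Tendsto (fun x : ℝ => (x, t)) (𝓝 1) (𝓝 (1, t)) :=
    (by fun_prop : Continuous fun x : ℝ => (x, t)).tendsto 1
  have hXt : HasDerivAt (partialX F 1) (S (0, 1) (1, 0)) t := by
    have h1 := HasFDerivAt.comp_hasDerivAt (f := fun s => ((1 : ℝ), s)) t hF'
      ((hasDerivAt_const t (1 : ℝ)).prodMk (hasDerivAt_id t))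
    have h2 := h1.clm_apply (hasDerivAt_const t ((1, 0) : ℝ × ℝ))
    simp only [map_zero, add_zero] at h2
    refine h2.congr_of_eventuallyEq ?_
    filter_upwards [hlineT.eventually hd] with s hs
    exact hs.partialX_eq
  have hcomp := HasFDerivAt.comp_hasDerivAt (f := fun x => (x, t)) 1 hF'
    ((hasDerivAt_id (1 : ℝ)).prodMk (hasDerivAt_const 1 t))
  have hTx : HasDerivAt (fun x => fderiv ℝ F (x, t) (0, 1)) (S (1, 0) (0, 1)) 1 := by
    have h2 := hcomp.clm_apply (hasDerivAt_const 1 ((0, 1) : ℝ × ℝ))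
    simpa using h2
  have hXx : HasDerivAt (fun x => fderiv ℝ F (x, t) (1, 0)) (S (1, 0) (1, 0)) 1 := by
    have h2 := hcomp.clm_apply (hasDerivAt_const 1 ((1, 0) : ℝ × ℝ))
    simpa using h2
  have hFx : HasDerivAt (fun x => F (x, t)) (fderiv ℝ F (1, t) (1, 0)) 1 :=
    HasFDerivAt.comp_hasDerivAt (f := fun x => (x, t)) 1 hd.self_of_nhds
      ((hasDerivAt_id (1 : ℝ)).prodMk (hasDerivAt_const 1 t))
  have hid : HasDerivAt (fun x : ℝ => x - 1) 1 1 := (hasDerivAt_id 1).sub_const 1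
  have hRHS := (((hid.mul ((hid.mul_const (β t)).add_const (γ t))).mul hXx).add
    (((hid.mul_const (δ t)).sub_const n).mul hFx)).add ((hasDerivAt_pow m (1 : ℝ)).const_mul n)
  have heq : (fun x => fderiv ℝ F (x, t) (0, 1)) =ᶠ[𝓝 1] fun x =>
      (x - 1) * ((x - 1) * β t + γ t) * fderiv ℝ F (x, t) (1, 0)
        + ((x - 1) * δ t - n) * F (x, t) + n * x ^ m := by
    filter_upwards [hlineX.eventually hs, hlineX.eventually hd] with x hx hdx
    rw [SolvesTransportAt, hdx.partialX_eq, hdx.partialT_eq] at hx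
    exact hx
  have huniq := (hTx.congr_of_eventuallyEq heq.symm).unique hRHS
  refine hXt.congr_deriv ?_
  rw [hsymm, huniq, hd.self_of_nhds.partialX_eq]
  simp
  ring

end PartialX

/-! ### Backward characteristics and the slope at x = 1. -/

section BackwardCharacteristics

open Set Filter Topology

variable {β γ δ : ℝ → ℝ}

/-- A function continuous on a compact interval agrees there with a continuous function. -/
theorem exists_continuous_eqOn_Icc {f : ℝ → ℝ} {s t : ℝ} (hst : s ≤ t)
    (hf : ContinuousOn f (Icc s t)) : ∃ g : ℝ → ℝ, Continuous g ∧ EqOn g f (Icc s t) :=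
  ⟨IccExtend hst ((Icc s t).domRestrict f), (continuousOn_iff_continuous_domRestrict.1 hf).Icc_extend',
    fun x hx => by rw [IccExtend_of_mem hst _ hx]; rfl⟩

/-- The fundamental solutions that describe the characteristics through points at time `t`. -/
theorem exists_backward_fundamental {s t : ℝ} (hst : s ≤ t) (hβ : ContinuousOn β (Icc s t))
    (hγ : ContinuousOn γ (Icc s t)) : ∃ K J : ℝ → ℝ, (∀ σ, 0 < K σ) ∧ K t = 1 ∧ J t = 0 ∧
      (∀ σ ∈ Icc s t, HasDerivAt K (-γ σ * K σ) σ) ∧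
      (∀ σ ∈ Icc s t, HasDerivAt J (-β σ * K σ) σ) := by
  -- The coefficients may be singular at time 0, so they are used only on [s,t] and extended
  -- continuously from there.
  obtain ⟨b, hb, hbe⟩ := exists_continuous_eqOn_Icc hst hβ
  obtain ⟨g, hg, hge⟩ := exists_continuous_eqOn_Icc hst hγ
  have hKt := charK_pos (γ := g) t
  refine ⟨fun σ => charK g σ / charK g t, fun σ => (charI b g t - charI b g σ) / charK g t,
    fun σ => div_pos (charK_pos σ) hKt, div_self hKt.ne', by simp, fun σ hσ => ?_, fun σ hσ => ?_⟩
  · refine ((hasDerivAt_charK hg σ).div_const _).congr_deriv ?_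
    rw [hge hσ]; ring
  · refine (((hasDerivAt_charI hb hg σ).const_sub _).div_const _).congr_deriv ?_
    rw [hbe hσ]; ring

theorem exists_integrating_factor {α : ℝ → ℝ} {s t : ℝ} (hst : s ≤ t)
    (hα : ContinuousOn α (Icc s t)) : ∃ E : ℝ → ℝ, (∀ σ, 0 < E σ) ∧
      ∀ σ ∈ Icc s t, HasDerivAt E (α σ * E σ) σ := by
  obtain ⟨E, -, hE, -, -, hd, -⟩ := exists_backward_fundamental (β := fun _ => 0) hst
    continuousOn_const hα.neg
  exact ⟨E, hE, fun σ hσ => (hd σ hσ).congr_deriv (by simp)⟩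

/-- In the variable W = 1 - x the characteristic equation becomes W' = W(βW - γ), again of Bernoulli
type. -/
theorem hasDerivAt_backward_char {K J : ℝ → ℝ} {σ w : ℝ} (hK : HasDerivAt K (-γ σ * K σ) σ)
    (hJ : HasDerivAt J (-β σ * K σ) σ) (h : 1 + w * J σ ≠ 0) :
    HasDerivAt (fun σ => w * K σ / (1 + w * J σ))
      (w * K σ / (1 + w * J σ) * (β σ * (w * K σ / (1 + w * J σ)) - γ σ)) σ := by
  refine ((hK.const_mul w).div ((hJ.const_mul w).const_add 1) h).congr_deriv ?_
  field_simp
  ring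

theorem antitoneOn_of_hasDerivAt {f f' : ℝ → ℝ} {s t : ℝ}
    (h : ∀ σ ∈ Icc s t, HasDerivAt f (f' σ) σ) (h' : ∀ σ ∈ Icc s t, f' σ ≤ 0) :
    AntitoneOn f (Icc s t) := by
  apply antitoneOn_of_deriv_nonpos (convex_Icc s t)
    fun σ hσ => (h σ hσ).continuousAt.continuousWithinAt
  · exact fun σ hσ => (h σ (interior_subset hσ)).differentiableAt.differentiableWithinAt
  · exact fun σ hσ => by rw [(h σ (interior_subset hσ)).deriv]; exact h' σ (interior_subset hσ)

theorem monotoneOn_of_hasDerivAt {f f' : ℝ → ℝ} {s t : ℝ}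
    (h : ∀ σ ∈ Icc s t, HasDerivAt f (f' σ) σ) (h' : ∀ σ ∈ Icc s t, 0 ≤ f' σ) :
    MonotoneOn f (Icc s t) := by
  apply monotoneOn_of_deriv_nonneg (convex_Icc s t)
    fun σ hσ => (h σ hσ).continuousAt.continuousWithinAt
  · exact fun σ hσ => (h σ (interior_subset hσ)).differentiableAt.differentiableWithinAt
  · exact fun σ hσ => by rw [(h σ (interior_subset hσ)).deriv]; exact h' σ (interior_subset hσ)

/-- If `γ ≤ β` and `0 ≤ β`, the backward characteristics from `[0, 1]` stay in `[0, 1]`. Here `W`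
is the distance to `x = 1`. -/
theorem exists_backward_char {s t w : ℝ} (hst : s ≤ t) (hβ : ContinuousOn β (Icc s t))
    (hγ : ContinuousOn γ (Icc s t)) (hβ0 : ∀ σ ∈ Icc s t, 0 ≤ β σ)
    (hγβ : ∀ σ ∈ Icc s t, γ σ ≤ β σ) (hw0 : 0 < w) (hw1 : w ≤ 1) :
    ∃ W : ℝ → ℝ, W t = w ∧ (∀ σ ∈ Icc s t, 0 < W σ ∧ W σ ≤ 1) ∧
      ∀ σ ∈ Icc s t, HasDerivAt W (W σ * (β σ * W σ - γ σ)) σ := by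
  obtain ⟨K, J, hK, hKt, hJt, hKd, hJd⟩ := exists_backward_fundamental hst hβ hγ
  have hJ : ∀ σ ∈ Icc s t, 0 ≤ J σ := by
    have : AntitoneOn J (Icc s t) := antitoneOn_of_hasDerivAt hJd fun σ hσ => by
      nlinarith [mul_nonneg (hβ0 σ hσ) (hK σ).le]
    intro σ hσ
    rw [← hJt]
    exact this hσ (right_mem_Icc.2 hst) hσ.2
  -- K - J has derivative (β-γ)K ≥ 0 and equals 1 at t. For w ≤ 1 it follows that wK ≤ 1 + wJ, that
  -- is, W ≤ 1.
  have hKJ : ∀ σ ∈ Icc s t, K σ ≤ 1 + J σ := by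
    have : MonotoneOn (fun σ => K σ - J σ) (Icc s t) :=
      monotoneOn_of_hasDerivAt (fun σ hσ => (hKd σ hσ).sub (hJd σ hσ)) fun σ hσ => by
        nlinarith [mul_nonneg (sub_nonneg.2 (hγβ σ hσ)) (hK σ).le]
    intro σ hσ
    have := this hσ (right_mem_Icc.2 hst) hσ.2
    simp only [hKt, hJt] at this
    linarith
  have hpos : ∀ σ ∈ Icc s t, 0 < 1 + w * J σ := fun σ hσ => by
    have := mul_nonneg hw0.le (hJ σ hσ)
    linarith
  refine ⟨fun σ => w * K σ / (1 + w * J σ), by simp [hKt, hJt], fun σ hσ => ⟨?_, ?_⟩,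
    fun σ hσ => hasDerivAt_backward_char (hKd σ hσ) (hJd σ hσ) (hpos σ hσ).ne'⟩
  · exact div_pos (mul_pos hw0 (hK σ)) (hpos σ hσ)
  · rw [div_le_one (hpos σ hσ)]
    nlinarith [mul_le_mul_of_nonneg_left (hKJ σ hσ) hw0.le]

/-- Backward characteristics near `x = 1` for bounded coefficients. -/
theorem exists_backward_char_of_bounded {s t w C : ℝ} (hst : s ≤ t) (hts : t - s ≤ 1)
    (hβ : ContinuousOn β (Icc s t)) (hγ : ContinuousOn γ (Icc s t))
    (hβC : ∀ σ ∈ Icc s t, |β σ| ≤ C) (hγC : ∀ σ ∈ Icc s t, |γ σ| ≤ C)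
    (hw0 : 0 < w) (hw1 : 2 * w * Real.exp C ≤ 1) (hw2 : 2 * w * (C * Real.exp C) ≤ 1) :
    ∃ W : ℝ → ℝ, W t = w ∧
      (∀ σ ∈ Icc s t, 0 < W σ ∧ W σ ≤ 2 * Real.exp C * w ∧ W σ ≤ 1) ∧
      ∀ σ ∈ Icc s t, HasDerivAt W (W σ * (β σ * W σ - γ σ)) σ := by
  have hC : 0 ≤ C := (abs_nonneg _).trans (hβC s (left_mem_Icc.2 hst))
  obtain ⟨K, J, hK, hKt, hJt, hKd, hJd⟩ := exists_backward_fundamental hst hβ hγ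
  have hKC : ∀ σ ∈ Icc s t, K σ ≤ Real.exp C := by
    have hmono : MonotoneOn (fun σ => K σ * Real.exp (C * σ)) (Icc s t) :=
      monotoneOn_of_hasDerivAt
        (fun σ hσ => (hKd σ hσ).mul (((hasDerivAt_id σ).const_mul C).exp)) fun σ hσ => by
        have h1 := (abs_le.1 (hγC σ hσ)).2
        have h2 := mul_nonneg (sub_nonneg.2 h1) (mul_pos (hK σ) (Real.exp_pos (C * σ))).le
        simp only [id, mul_one]
        nlinarith
    intro σ hσ
    have h1 := hmono hσ (right_mem_Icc.2 hst) hσ.2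
    simp only [hKt, one_mul] at h1
    have h2 : Real.exp (C * t) ≤ Real.exp C * Real.exp (C * σ) := by
      rw [← Real.exp_add]
      apply Real.exp_le_exp.2
      nlinarith [hσ.1]
    exact le_of_mul_le_mul_right (h1.trans h2) (Real.exp_pos _)
  have hJC : ∀ σ ∈ Icc s t, -(C * Real.exp C) ≤ J σ := by
    have hmono : AntitoneOn (fun σ => J σ - C * Real.exp C * σ) (Icc s t) :=
      antitoneOn_of_hasDerivAt
        (fun σ hσ => (hJd σ hσ).sub ((hasDerivAt_id σ).const_mul (C * Real.exp C))) fun σ hσ => by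
        have h1 := (abs_le.1 (hβC σ hσ)).1
        have h2 := mul_nonneg (show 0 ≤ C + β σ by linarith) (hK σ).le
        have h3 := mul_le_mul_of_nonneg_left (hKC σ hσ) hC
        simp only [mul_one]
        nlinarith
    intro σ hσ
    have h1 := hmono hσ (right_mem_Icc.2 hst) hσ.2
    simp only [hJt] at h1
    have h2 : C * Real.exp C * (t - σ) ≤ C * Real.exp C * 1 :=
      mul_le_mul_of_nonneg_left (by linarith [hσ.1]) (by positivity)
    linarith
  -- No sign of β is assumed here; the smallness of w keeps the denominator away from 0.
  have hpos : ∀ σ ∈ Icc s t, 1 / 2 ≤ 1 + w * J σ := fun σ hσ => by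
    have := mul_le_mul_of_nonneg_left (hJC σ hσ) hw0.le
    linarith
  have hle : ∀ σ ∈ Icc s t, w * K σ / (1 + w * J σ) ≤ 2 * Real.exp C * w := fun σ hσ => by
    rw [div_le_iff₀ (by linarith [hpos σ hσ])]
    have h1 := mul_le_mul_of_nonneg_left (hKC σ hσ) hw0.le
    have h2 := mul_le_mul_of_nonneg_left (hpos σ hσ)
      (show 0 ≤ 2 * Real.exp C * w by positivity)
    linarith
  refine ⟨fun σ => w * K σ / (1 + w * J σ), by simp [hKt, hJt], fun σ hσ =>
    ⟨div_pos (mul_pos hw0 (hK σ)) (by linarith [hpos σ hσ]), hle σ hσ, (hle σ hσ).trans ?_⟩,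
    fun σ hσ => hasDerivAt_backward_char (hKd σ hσ) (hJd σ hσ) (by linarith [hpos σ hσ])⟩
  linarith

/-- A solution on `[0, 1] × (0, ∞)` of the transport equation that equals `1` at `x = 1` and
attains the initial values `h` uniformly on `[0, 1]`. -/
structure IsTransportSolution (β γ δ : ℝ → ℝ) (n : ℝ) (m : ℕ) (h : ℝ → ℝ) (F : ℝ × ℝ → ℝ) :
    Prop where
  differentiableAt : ∀ x ∈ Icc (0 : ℝ) 1, ∀ t, 0 < t → DifferentiableAt ℝ F (x, t)
  equation : ∀ x ∈ Icc (0 : ℝ) 1, ∀ t, 0 < t → SolvesTransportAt β γ δ n m F x t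
  initial : ∀ ε, 0 < ε → ∃ s₀, 0 < s₀ ∧ ∀ s ∈ Ioo 0 s₀, ∀ x ∈ Icc (0 : ℝ) 1,
    |F (x, s) - h x| < ε
  eq_one : ∀ t, 0 < t → F (1, t) = 1

namespace IsTransportSolution

variable {n : ℝ} {m : ℕ} {h : ℝ → ℝ} {F : ℝ × ℝ → ℝ}

/-- The equation for `1 - F` along backward characteristics. -/
theorem hasDerivAt_one_sub (hF : IsTransportSolution β γ δ n m h F) {W : ℝ → ℝ} {σ : ℝ}
    (hσ : 0 < σ) (hW0 : 0 < W σ) (hW1 : W σ ≤ 1)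
    (hW : HasDerivAt W (W σ * (β σ * W σ - γ σ)) σ) :
    HasDerivAt (fun σ => 1 - F (1 - W σ, σ))
      (-((W σ * δ σ + n) * (1 - F (1 - W σ, σ))) + (W σ * δ σ + n * (1 - (1 - W σ) ^ m))) σ := by
  have hmem : 1 + -W σ ∈ Icc (0 : ℝ) 1 := ⟨by linarith, by linarith⟩
  have h1 := SolvesTransportAt.hasDerivAt_comp (Y := fun σ => -W σ)
    (hF.differentiableAt _ hmem σ hσ) (hF.equation _ hmem σ hσ) (hW.neg.congr_deriv (by ring))
  simp only [← sub_eq_add_neg] at h1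
  exact (h1.const_sub 1).congr_deriv (by ring)

/-- As F(1,t) = 1, this is a difference quotient at x = 1. Bounds for 1 - F(1-w,t) that are linear
in small w thus become bounds for F_x(1,t). -/
theorem tendsto_slope (hF : IsTransportSolution β γ δ n m h F) {t : ℝ} (ht : 0 < t) :
    Tendsto (fun w => (1 - F (1 - w, t)) / w) (𝓝[>] 0) (𝓝 (partialX F 1 t)) := by
  have hd : HasDerivAt (fun x => F (x, t)) (partialX F 1 t) 1 := by
    have h1 : DifferentiableAt ℝ (fun x => F (x, t)) 1 :=
      (hF.differentiableAt 1 ⟨zero_le_one, le_rfl⟩ t ht).comp (f := fun x : ℝ => (x, t)) 1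
        (by fun_prop)
    exact h1.hasDerivAt
  have hd' : HasDerivAt (fun w => -F (1 - w, t)) (partialX F 1 t) 0 := by
    have h2 : HasDerivAt (fun w : ℝ => 1 - w) (-1) 0 := (hasDerivAt_id 0).const_sub 1
    have h3 := HasDerivAt.comp (h := fun w : ℝ => 1 - w) (h₂ := fun x => F (x, t)) 0
      (by simpa using hd) h2
    exact h3.neg.congr_deriv (by ring)
  have h4 := hd'.tendsto_slope.mono_left
    (nhdsWithin_mono (0 : ℝ) (fun x (hx : x ∈ Ioi 0) => ne_of_gt hx))
  refine h4.congr fun w => ?_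
  simp only [slope_def_field, sub_zero, hF.eq_one t ht]
  ring

theorem partialX_le (hF : IsTransportSolution β γ δ n m h F) {t C : ℝ} (ht : 0 < t)
    (hC : ∀ᶠ w in 𝓝[>] 0, 1 - F (1 - w, t) ≤ C * w) : partialX F 1 t ≤ C := by
  refine le_of_tendsto (hF.tendsto_slope ht) ?_
  filter_upwards [hC, self_mem_nhdsWithin] with w hw hw0
  exact (div_le_iff₀ hw0).2 hw

theorem le_partialX (hF : IsTransportSolution β γ δ n m h F) {t C : ℝ} (ht : 0 < t)
    (hC : ∀ᶠ w in 𝓝[>] 0, C * w ≤ 1 - F (1 - w, t)) : C ≤ partialX F 1 t := by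
  refine ge_of_tendsto (hF.tendsto_slope ht) ?_
  filter_upwards [hC, self_mem_nhdsWithin] with w hw hw0
  exact (le_div_iff₀ hw0).2 hw

end IsTransportSolution

/-- Bernoulli's inequality; it controls the source term in the equation for 1 - F. -/
theorem one_sub_one_sub_pow_mem {W : ℝ} (h0 : 0 ≤ W) (h1 : W ≤ 1) (m : ℕ) :
    0 ≤ 1 - (1 - W) ^ m ∧ 1 - (1 - W) ^ m ≤ m * W := by
  have h2 := one_add_mul_le_pow (show -2 ≤ -W by linarith) m
  rw [← sub_eq_add_neg] at h2
  have h3 : (1 - W) ^ m ≤ 1 := pow_le_one₀ (by linarith) (by linarith)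
  constructor <;> linarith

end BackwardCharacteristics

/-! ### Bounds for the slope at x = 1 and its limit at t = 0. -/

section SlopeBounds

open Set Filter Topology

namespace IsTransportSolution

variable {β γ δ : ℝ → ℝ} {n : ℝ} {m : ℕ} {h : ℝ → ℝ} {F : ℝ × ℝ → ℝ}

/-- A lower bound for `F_x (1, t)` that does not need a bound for `β`. -/
theorem lower_bound (hF : IsTransportSolution β γ δ n m h F) (hβ : ContinuousOn β (Ioi 0))
    (hγ : ContinuousOn γ (Ioi 0)) (hδ : ContinuousOn δ (Ioi 0)) (hn : 0 ≤ n) {C κ : ℝ} (hκ : 0 < κ)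
    (hβ0 : ∀ t ∈ Ioc (0 : ℝ) 1, 0 ≤ β t) (hγβ : ∀ t ∈ Ioc (0 : ℝ) 1, γ t ≤ β t)
    (hδ0 : ∀ t ∈ Ioc (0 : ℝ) 1, 0 ≤ δ t) (hβγC : ∀ t ∈ Ioc (0 : ℝ) 1, β t - γ t ≤ C)
    (hδC : ∀ t ∈ Ioc (0 : ℝ) 1, δ t + n ≤ C)
    (hh : ∀ x ∈ Icc (0 : ℝ) 1, κ * (1 - x) ≤ 1 - h x) {t : ℝ} (ht : t ∈ Ioc (0 : ℝ) 1) :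
    Real.exp (-C) * (κ * Real.exp (-C) / 2) ≤ partialX F 1 t := by
  have hC : 0 ≤ C := (sub_nonneg.2 (hγβ t ht)).trans (hβγC t ht)
  apply hF.le_partialX ht.1
  filter_upwards [Ioo_mem_nhdsGT (zero_lt_one' ℝ)] with w hw
  -- Half of the lower bound κ exp(-C) w for κ W(s); the other half absorbs the error in the initial
  -- values at time s. The time s therefore depends on w.
  set b := κ * Real.exp (-C) * w / 2 with hb
  have hb0 : 0 < b := by have := hw.1; positivity
  obtain ⟨s₀, hs₀, hinit⟩ := hF.initial b hb0
  obtain ⟨s, hs0, hss₀, hst⟩ : ∃ s, 0 < s ∧ s < s₀ ∧ s < t :=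
    ⟨min s₀ t / 2, by have := lt_min hs₀ ht.1; linarith,
      by have := lt_min hs₀ ht.1; linarith [min_le_left s₀ t],
      by have := lt_min hs₀ ht.1; linarith [min_le_right s₀ t]⟩
  have hsub : Icc s t ⊆ Ioi 0 := fun σ hσ => hs0.trans_le hσ.1
  have hsub1 : ∀ σ ∈ Icc s t, σ ∈ Ioc (0 : ℝ) 1 := fun σ hσ => ⟨hsub hσ, hσ.2.trans ht.2⟩
  have hsm : s ∈ Icc s t := left_mem_Icc.2 hst.le
  have htm : t ∈ Icc s t := right_mem_Icc.2 hst.le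
  obtain ⟨W, hWt, hW, hWd⟩ := exists_backward_char hst.le (hβ.mono hsub) (hγ.mono hsub)
    (fun σ hσ => hβ0 σ (hsub1 σ hσ)) (fun σ hσ => hγβ σ (hsub1 σ hσ)) hw.1 hw.2.le
  have hWc : ContinuousOn W (Icc s t) := fun σ hσ => (hWd σ hσ).continuousAt.continuousWithinAt
  obtain ⟨E, hE, hEd⟩ := exists_integrating_factor (α := fun σ => W σ * δ σ + n) hst.le
    ((hWc.mul (hδ.mono hsub)).add continuousOn_const)
  -- As W ≤ 1 and β ≥ 0, W' = W(βW-γ) ≤ (β-γ)W ≤ CW. Only β - γ needs an upper bound; in the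
  -- application the singular term q/v cancels in it.
  have hWs : w * Real.exp (-C) ≤ W s := by
    have hanti : AntitoneOn (fun σ => W σ * Real.exp (-(C * σ))) (Icc s t) :=
      antitoneOn_of_hasDerivAt
        (fun σ hσ => (hWd σ hσ).mul (((hasDerivAt_id σ).const_mul C).neg.exp)) fun σ hσ => by
        have h1 := hβγC σ (hsub1 σ hσ)
        have h2 := mul_nonneg (sub_nonneg.2 (hW σ hσ).2) (hβ0 σ (hsub1 σ hσ))
        have h3 := mul_nonneg (show 0 ≤ C - (β σ * W σ - γ σ) by nlinarith)
          (mul_pos (hW σ hσ).1 (Real.exp_pos (-(C * σ)))).le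
        simp only [id, mul_one, Pi.neg_apply]
        nlinarith
    have h1 := hanti hsm htm hst.le
    simp only [hWt] at h1
    have h2 : Real.exp (-C) ≤ Real.exp (-(C * t)) := Real.exp_le_exp.2 (by nlinarith [ht.2])
    have h3 : Real.exp (-(C * s)) ≤ 1 := Real.exp_le_one_iff.2 (by nlinarith)
    nlinarith [mul_le_mul_of_nonneg_left h2 hw.1.le, mul_le_mul_of_nonneg_left h3 (hW s hsm).1.le]
  have hfs : b ≤ 1 - F (1 - W s, s) := by
    have hmem : 1 - W s ∈ Icc (0 : ℝ) 1 := ⟨by linarith [(hW s hsm).2], by linarith [(hW s hsm).1]⟩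
    have h1 := (abs_lt.1 (hinit s ⟨hs0, hss₀⟩ _ hmem)).2
    have h2 := hh _ hmem
    have h3 := mul_le_mul_of_nonneg_left hWs hκ.le
    rw [hb] at h1 ⊢
    linarith
  -- After removal of the damping by E, only the nonnegative source Wδ + n(1-(1-W)^m) remains.
  have hmono : MonotoneOn (fun σ => (1 - F (1 - W σ, σ)) * E σ) (Icc s t) :=
    monotoneOn_of_hasDerivAt (fun σ hσ =>
      (hF.hasDerivAt_one_sub (hsub hσ) (hW σ hσ).1 (hW σ hσ).2 (hWd σ hσ)).mul (hEd σ hσ))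
      fun σ hσ => by
        have h1 := (one_sub_one_sub_pow_mem (hW σ hσ).1.le (hW σ hσ).2 m).1
        have h2 := mul_nonneg (hW σ hσ).1.le (hδ0 σ (hsub1 σ hσ))
        have h3 := mul_nonneg (add_nonneg h2 (mul_nonneg hn h1)) (hE σ).le
        linarith
  have hEanti : AntitoneOn (fun σ => E σ * Real.exp (-(C * σ))) (Icc s t) :=
    antitoneOn_of_hasDerivAt
      (fun σ hσ => (hEd σ hσ).mul (((hasDerivAt_id σ).const_mul C).neg.exp)) fun σ hσ => by
      have h1 := hδC σ (hsub1 σ hσ)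
      have h2 := mul_nonneg (sub_nonneg.2 (hW σ hσ).2) (hδ0 σ (hsub1 σ hσ))
      have h3 := mul_nonneg (show 0 ≤ C - (W σ * δ σ + n) by nlinarith)
        (mul_pos (hE σ) (Real.exp_pos (-(C * σ)))).le
      simp only [id, mul_one, Pi.neg_apply]
      nlinarith
  have hEt : E t * Real.exp (-C) ≤ E s := by
    have h1 := hEanti hsm htm hst.le
    simp only at h1
    have h2 : Real.exp (-C) ≤ Real.exp (-(C * t)) := Real.exp_le_exp.2 (by nlinarith [ht.2])
    have h3 : Real.exp (-(C * s)) ≤ 1 := Real.exp_le_one_iff.2 (by nlinarith)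
    nlinarith [mul_le_mul_of_nonneg_left h2 (hE t).le, mul_le_mul_of_nonneg_left h3 (hE s).le]
  have hfin := hmono hsm htm hst.le
  simp only [hWt] at hfin
  have h4 : b * (E t * Real.exp (-C)) ≤ (1 - F (1 - w, t)) * E t :=
    (mul_le_mul hfs hEt (by have := hE t; positivity) (hb0.le.trans hfs)).trans hfin
  have h5 : b * Real.exp (-C) ≤ 1 - F (1 - w, t) :=
    le_of_mul_le_mul_right (by linarith) (hE t)
  calc _ = b * Real.exp (-C) := by rw [hb]; ring
    _ ≤ _ := h5

/-- An upper bound for `F_x (1, t)` when the characteristics spread faster than `F` grows. -/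
theorem upper_bound (hF : IsTransportSolution β γ δ n m h F) (hβ : ContinuousOn β (Ioi 0))
    (hγ : ContinuousOn γ (Ioi 0)) (hδ : ContinuousOn δ (Ioi 0)) (hn : 0 ≤ n) {t C C' w₀ : ℝ}
    (ht : 0 < t) (hC : 0 ≤ C) (hC' : 0 ≤ C') (hβ0 : ∀ s ∈ Ioc 0 t, 0 ≤ β s)
    (hγ0 : ∀ s ∈ Ioc 0 t, γ s ≤ 0) (hδ0 : ∀ s ∈ Ioc 0 t, 0 ≤ δ s)
    (hδγ : ∀ s ∈ Ioc 0 t, δ s + n * m ≤ C * -γ s) (hw₀ : 0 < w₀)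
    (hh : ∀ w ∈ Ioo 0 w₀, 1 - h (1 - w) ≤ C' * w) : partialX F 1 t ≤ C + C' + 1 := by
  apply hF.partialX_le ht
  filter_upwards [Ioo_mem_nhdsGT (lt_min hw₀ (zero_lt_one' ℝ))] with w hw
  obtain ⟨s₀, hs₀, hinit⟩ := hF.initial w hw.1
  obtain ⟨s, hs0, hss₀, hst⟩ : ∃ s, 0 < s ∧ s < s₀ ∧ s < t :=
    ⟨min s₀ t / 2, by have := lt_min hs₀ ht; linarith,
      by have := lt_min hs₀ ht; linarith [min_le_left s₀ t],
      by have := lt_min hs₀ ht; linarith [min_le_right s₀ t]⟩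
  have hsub : Icc s t ⊆ Ioi 0 := fun σ hσ => hs0.trans_le hσ.1
  have hsub1 : ∀ σ ∈ Icc s t, σ ∈ Ioc (0 : ℝ) t := fun σ hσ => ⟨hsub hσ, hσ.2⟩
  have hsm : s ∈ Icc s t := left_mem_Icc.2 hst.le
  have htm : t ∈ Icc s t := right_mem_Icc.2 hst.le
  obtain ⟨W, hWt, hW, hWd⟩ := exists_backward_char hst.le (hβ.mono hsub) (hγ.mono hsub)
    (fun σ hσ => hβ0 σ (hsub1 σ hσ))
    (fun σ hσ => (hγ0 σ (hsub1 σ hσ)).trans (hβ0 σ (hsub1 σ hσ))) hw.1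
    (hw.2.le.trans (min_le_right _ _))
  have hWc : ContinuousOn W (Icc s t) := fun σ hσ => (hWd σ hσ).continuousAt.continuousWithinAt
  obtain ⟨E, hE, hEd⟩ := exists_integrating_factor (α := fun σ => W σ * δ σ + n) hst.le
    ((hWc.mul (hδ.mono hsub)).add continuousOn_const)
  have hWs : W s ≤ w := by
    rw [← hWt]
    refine monotoneOn_of_hasDerivAt hWd (fun σ hσ => mul_nonneg (hW σ hσ).1.le ?_) hsm htm hst.le
    linarith [mul_nonneg (hβ0 σ (hsub1 σ hσ)) (hW σ hσ).1.le, hγ0 σ (hsub1 σ hσ)]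
  have hEst : E s ≤ E t := by
    refine monotoneOn_of_hasDerivAt hEd (fun σ hσ => mul_nonneg ?_ (hE σ).le) hsm htm hst.le
    exact add_nonneg (mul_nonneg (hW σ hσ).1.le (hδ0 σ (hsub1 σ hσ))) hn
  have hfs : 1 - F (1 - W s, s) ≤ (C' + 1) * w := by
    have hmem : 1 - W s ∈ Icc (0 : ℝ) 1 := ⟨by linarith [(hW s hsm).2], by linarith [(hW s hsm).1]⟩
    have h1 := (abs_lt.1 (hinit s ⟨hs0, hss₀⟩ _ hmem)).1
    have h2 := hh (W s) ⟨(hW s hsm).1, hWs.trans_lt (hw.2.trans_le (min_le_left _ _))⟩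
    nlinarith [mul_le_mul_of_nonneg_left hWs hC']
  -- The source is at most W(δ+nm) ≤ C(-γ)W, and CW grows at least at the rate C(-γ)W because β ≥ 0.
  -- Hence CW dominates the growth of 1 - F.
  have hanti : AntitoneOn (fun σ => (1 - F (1 - W σ, σ) - C * W σ) * E σ) (Icc s t) :=
    antitoneOn_of_hasDerivAt (fun σ hσ =>
      ((hF.hasDerivAt_one_sub (hsub hσ) (hW σ hσ).1 (hW σ hσ).2 (hWd σ hσ)).sub
        ((hWd σ hσ).const_mul C)).mul (hEd σ hσ))
      fun σ hσ => by
        have hW0 := (hW σ hσ).1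
        have h1 := (one_sub_one_sub_pow_mem hW0.le (hW σ hσ).2 m).2
        have h2 := mul_nonneg hW0.le (hδ0 σ (hsub1 σ hσ))
        have h3 := mul_le_mul_of_nonneg_left h1 hn
        have h4 := mul_le_mul_of_nonneg_left (hδγ σ (hsub1 σ hσ)) hW0.le
        have h5 : 0 ≤ (W σ * δ σ + n) * (C * W σ) :=
          mul_nonneg (add_nonneg h2 hn) (mul_nonneg hC hW0.le)
        have h6 : 0 ≤ C * (W σ * (β σ * W σ)) :=
          mul_nonneg hC (mul_nonneg hW0.le (mul_nonneg (hβ0 σ (hsub1 σ hσ)) hW0.le))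
        have h7 : W σ * δ σ + n * (1 - (1 - W σ) ^ m) - (W σ * δ σ + n) * (C * W σ)
            - C * (W σ * (β σ * W σ - γ σ)) ≤ 0 := by nlinarith
        have h8 := mul_nonneg (neg_nonneg.2 h7) (hE σ).le
        simp only [Pi.sub_apply]
        linarith
  have hfin := hanti hsm htm hst.le
  simp only [hWt] at hfin
  have h1 : (1 - F (1 - W s, s) - C * W s) * E s ≤ (C' + 1) * w * E s :=
    mul_le_mul_of_nonneg_right (by linarith [mul_nonneg hC (hW s hsm).1.le]) (hE s).le
  have h2 : (C' + 1) * w * E s ≤ (C' + 1) * w * E t :=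
    mul_le_mul_of_nonneg_left hEst (by have := hw.1; positivity)
  have h3 := le_of_mul_le_mul_right ((hfin.trans h1).trans h2) (hE t)
  linarith

/-- If the coefficients are bounded, `F_x (1, t)` tends to the derivative of the initial values. -/
theorem tendsto_partialX (hF : IsTransportSolution β γ δ n m h F) (hβ : ContinuousOn β (Ioi 0))
    (hγ : ContinuousOn γ (Ioi 0)) (hn : 0 ≤ n) {C h₁ : ℝ}
    (hβC : ∀ t ∈ Ioc (0 : ℝ) 1, |β t| ≤ C) (hγC : ∀ t ∈ Ioc (0 : ℝ) 1, |γ t| ≤ C)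
    (hδC : ∀ t ∈ Ioc (0 : ℝ) 1, |δ t| ≤ C) (hh1 : h 1 = 1) (hh : HasDerivAt h h₁ 1) :
    Tendsto (partialX F 1) (𝓝[>] 0) (𝓝 h₁) := by
  have hC : 0 ≤ C := (abs_nonneg _).trans (hβC 1 ⟨zero_lt_one, le_rfl⟩)
  set A := 2 * (C + n + n * m) with hA
  have hnm : 0 ≤ n * m := by positivity
  have hA0 : 0 ≤ A := by positivity
  set C₁ := A * Real.exp A with hC₁
  have hC₁0 : 0 ≤ C₁ := by positivity
  set C₂ := 2 * Real.exp C with hC₂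
  have hC₂0 : 0 < C₂ := by positivity
  set C₃ := (1 + |h₁|) * C₁ * ((|h₁| + 2) * C₂ + 1) with hC₃
  have hC₃0 : 0 ≤ C₃ := by positivity
  -- The factor η measures both the linearisation error of h at 1 and the initial error at time s.
  -- It is sent to 0 with t fixed, once w → 0 has produced the slope.
  have key : ∀ t ∈ Ioc (0 : ℝ) 1, ∀ η ∈ Ioo (0 : ℝ) 1, ∀ᶠ w in 𝓝[>] 0,
      |1 - F (1 - w, t) - h₁ * w| ≤ (C₃ * t + η * (1 + C₂)) * w := by
    intro t ht η hη
    have hlin : ∀ᶠ W in 𝓝[>] (0 : ℝ), |1 - h (1 - W) - h₁ * W| ≤ η * W := by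
      have h1 := (hasDerivAt_iff_isLittleO.1 hh).def hη.1
      have h2 : Tendsto (fun W : ℝ => 1 - W) (𝓝[>] 0) (𝓝 1) := by
        have : Tendsto (fun W : ℝ => 1 - W) (𝓝 0) (𝓝 (1 - 0)) :=
          (continuous_const.sub continuous_id).tendsto 0
        rw [sub_zero] at this
        exact this.mono_left nhdsWithin_le_nhds
      filter_upwards [h2.eventually h1, self_mem_nhdsWithin] with W hW hW0
      rw [hh1, Real.norm_eq_abs, Real.norm_eq_abs, show 1 - W - 1 = -W by ring, abs_neg,
        abs_of_pos (a := W) hW0, smul_eq_mul] at hW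
      rw [← abs_neg]
      convert hW using 2
      ring
    obtain ⟨W₀, hW₀, hlin'⟩ := mem_nhdsGT_iff_exists_Ioo_subset.1 hlin
    replace hW₀ : 0 < W₀ := hW₀
    have hw₀ : 0 < min (W₀ / C₂) (min (1 / C₂) (1 / (2 * (C * Real.exp C) + 1))) := by
      apply lt_min (by positivity) (lt_min (by positivity) (by positivity))
    filter_upwards [Ioo_mem_nhdsGT hw₀] with w hw
    have hw1 : C₂ * w < W₀ := by
      have := hw.2.trans_le (min_le_left _ _)
      rw [lt_div_iff₀ hC₂0] at this
      linarith
    have hw2 : 2 * w * Real.exp C ≤ 1 := by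
      have := (hw.2.trans_le ((min_le_right _ _).trans (min_le_left _ _))).le
      rw [le_div_iff₀ hC₂0, hC₂] at this
      linarith
    have hw3 : 2 * w * (C * Real.exp C) ≤ 1 := by
      have := (hw.2.trans_le ((min_le_right _ _).trans (min_le_right _ _))).le
      rw [le_div_iff₀ (by positivity)] at this
      linarith [hw.1]
    obtain ⟨s₀, hs₀, hinit⟩ := hF.initial (η * w) (mul_pos hη.1 hw.1)
    obtain ⟨s, hs0, hss₀, hst⟩ : ∃ s, 0 < s ∧ s < s₀ ∧ s < t :=
      ⟨min s₀ t / 2, by have := lt_min hs₀ ht.1; linarith,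
        by have := lt_min hs₀ ht.1; linarith [min_le_left s₀ t],
        by have := lt_min hs₀ ht.1; linarith [min_le_right s₀ t]⟩
    have hsub : Icc s t ⊆ Ioi 0 := fun σ hσ => hs0.trans_le hσ.1
    have hsub1 : ∀ σ ∈ Icc s t, σ ∈ Ioc (0 : ℝ) 1 := fun σ hσ => ⟨hsub hσ, hσ.2.trans ht.2⟩
    have hsm : s ∈ Icc s t := left_mem_Icc.2 hst.le
    have htm : t ∈ Icc s t := right_mem_Icc.2 hst.le
    obtain ⟨W, hWt, hW, hWd⟩ := exists_backward_char_of_bounded hst.le (by linarith [ht.2])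
      (hβ.mono hsub) (hγ.mono hsub) (fun σ hσ => hβC σ (hsub1 σ hσ))
      (fun σ hσ => hγC σ (hsub1 σ hσ)) hw.1 hw2 hw3
    -- The pair (1-F, W) obeys |Z'| ≤ A|Z|, so between s and t it changes by at most a multiple of
    -- |Z(s)| t, while |Z(s)| is of order w.
    set Z : ℝ → ℝ × ℝ := fun σ => (1 - F (1 - W σ, σ), W σ) with hZ
    set Z' : ℝ → ℝ × ℝ := fun σ =>
      (-((W σ * δ σ + n) * (1 - F (1 - W σ, σ))) + (W σ * δ σ + n * (1 - (1 - W σ) ^ m)),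
        W σ * (β σ * W σ - γ σ)) with hZ'
    have hZd : ∀ σ ∈ Icc s t, HasDerivAt Z (Z' σ) σ := fun σ hσ =>
      (hF.hasDerivAt_one_sub (hsub hσ) (hW σ hσ).1 (hW σ hσ).2.2 (hWd σ hσ)).prodMk (hWd σ hσ)
    have hZA : ∀ σ ∈ Icc s t, ‖Z' σ‖ ≤ A * ‖Z σ‖ := by
      intro σ hσ
      have hW0 := (hW σ hσ).1
      have hW1 := (hW σ hσ).2.2
      have hb := hβC σ (hsub1 σ hσ)
      have hg := hγC σ (hsub1 σ hσ)
      have hd := hδC σ (hsub1 σ hσ)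
      have hp := one_sub_one_sub_pow_mem hW0.le hW1 m
      have hZ1 : |1 - F (1 - W σ, σ)| ≤ ‖Z σ‖ := norm_fst_le (Z σ)
      have hZ2 : W σ ≤ ‖Z σ‖ := (le_abs_self _).trans (norm_snd_le (Z σ))
      have hZ0 := norm_nonneg (Z σ)
      have hWδ : |W σ * δ σ| ≤ C * W σ := by
        rw [abs_mul, abs_of_pos hW0, mul_comm]
        exact mul_le_mul_of_nonneg_right hd hW0.le
      have hWδ1 : |W σ * δ σ| ≤ C := hWδ.trans (mul_le_of_le_one_right hC hW1)
      refine max_le ?_ ?_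
      · calc ‖(Z' σ).1‖ ≤ |(W σ * δ σ + n) * (1 - F (1 - W σ, σ))|
              + |W σ * δ σ + n * (1 - (1 - W σ) ^ m)| := by
              rw [← abs_neg ((W σ * δ σ + n) * _)]; exact abs_add_le _ _
          _ ≤ (C + n) * ‖Z σ‖ + (C + n * m) * ‖Z σ‖ := by
              apply add_le_add
              · rw [abs_mul]
                refine mul_le_mul ((abs_add_le _ _).trans ?_) hZ1 (abs_nonneg _) (by positivity)
                rw [abs_of_nonneg hn]
                linarith
              · refine (abs_add_le _ _).trans ?_
                rw [abs_of_nonneg (mul_nonneg hn hp.1)]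
                have h1 := mul_le_mul_of_nonneg_left hp.2 hn
                have h2 := mul_le_mul_of_nonneg_left hZ2 hC
                have h3 := mul_le_mul_of_nonneg_left hZ2 hnm
                linarith
          _ ≤ A * ‖Z σ‖ := by
              rw [← add_mul]
              exact mul_le_mul_of_nonneg_right (by rw [hA]; linarith) hZ0
      · calc ‖(Z' σ).2‖ = W σ * |β σ * W σ - γ σ| := by
              rw [Real.norm_eq_abs, abs_mul, abs_of_pos hW0]
          _ ≤ ‖Z σ‖ * A := by
              refine mul_le_mul hZ2 ((abs_sub _ _).trans ?_) (abs_nonneg _) hZ0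
              rw [abs_mul, abs_of_pos hW0]
              have := mul_le_mul hb hW1 hW0.le hC
              rw [hA]
              linarith
          _ = _ := mul_comm _ _
    have hZc : ContinuousOn Z (Icc s t) := fun σ hσ => (hZd σ hσ).continuousAt.continuousWithinAt
    have hgron : ∀ σ ∈ Icc s t, ‖Z σ‖ ≤ ‖Z s‖ * Real.exp A := by
      intro σ hσ
      have h1 := norm_le_gronwallBound_of_norm_deriv_right_le (K := A) (ε := 0) (δ := ‖Z s‖) hZc
        (fun σ hσ => (hZd σ (Ico_subset_Icc_self hσ)).hasDerivWithinAt) le_rfl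
        (fun σ hσ => by simpa using hZA σ (Ico_subset_Icc_self hσ)) σ hσ
      rw [gronwallBound_ε0] at h1
      refine h1.trans (mul_le_mul_of_nonneg_left (Real.exp_le_exp.2 ?_) (norm_nonneg _))
      exact mul_le_of_le_one_right hA0 (by linarith [hσ.2, ht.2])
    have hdiff : ‖Z t - Z s‖ ≤ C₁ * ‖Z s‖ * t := by
      have h1 := norm_image_sub_le_of_norm_deriv_le_segment' (f := Z) (f' := Z') (C := C₁ * ‖Z s‖)
        (fun σ hσ => (hZd σ hσ).hasDerivWithinAt)
        (fun σ hσ => by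
          refine (hZA σ (Ico_subset_Icc_self hσ)).trans ?_
          have := mul_le_mul_of_nonneg_left (hgron σ (Ico_subset_Icc_self hσ)) hA0
          rw [hC₁]
          linarith) t htm
      exact h1.trans (mul_le_mul_of_nonneg_left (by linarith) (by positivity))
    have hd1 : |1 - F (1 - w, t) - (1 - F (1 - W s, s))| ≤ C₁ * ‖Z s‖ * t := by
      have := (norm_fst_le (Z t - Z s)).trans hdiff
      simpa only [hZ, Prod.fst_sub, hWt, Real.norm_eq_abs] using this
    have hd2 : |w - W s| ≤ C₁ * ‖Z s‖ * t := by
      have := (norm_snd_le (Z t - Z s)).trans hdiff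
      simpa only [hZ, Prod.snd_sub, hWt, Real.norm_eq_abs] using this
    have hWs := hW s hsm
    have hmem : 1 - W s ∈ Icc (0 : ℝ) 1 := ⟨by linarith [hWs.2.2], by linarith [hWs.1]⟩
    have hi := (hinit s ⟨hs0, hss₀⟩ _ hmem).le
    have hl : |1 - h (1 - W s) - h₁ * W s| ≤ η * W s := hlin' ⟨hWs.1, hWs.2.1.trans_lt hw1⟩
    have hN : ‖Z s‖ ≤ ((|h₁| + 2) * C₂ + 1) * w := by
      have hηw : η * w ≤ w := mul_le_of_le_one_left hw.1.le hη.2.le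
      have hηW : η * W s ≤ W s := mul_le_of_le_one_left hWs.1.le hη.2.le
      have h1W : |h₁| * W s ≤ |h₁| * (C₂ * w) := mul_le_mul_of_nonneg_left hWs.2.1 (abs_nonneg _)
      have hhW : |h₁ * W s| = |h₁| * W s := by rw [abs_mul, abs_of_pos hWs.1]
      have hC₂w := mul_pos hC₂0 hw.1
      refine max_le ?_ ?_
      · have h1 : ‖(Z s).1‖ ≤ |1 - h (1 - W s) - h₁ * W s| + |h₁ * W s|
            + |F (1 - W s, s) - h (1 - W s)| := by
          have : (Z s).1 = (1 - h (1 - W s) - h₁ * W s) + h₁ * W s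
            - (F (1 - W s, s) - h (1 - W s)) := by simp only [hZ]; ring
          rw [this]
          exact (abs_sub _ _).trans (add_le_add_left (abs_add_le _ _) _)
        rw [hhW] at h1
        linarith [hWs.2.1]
      · have h1 : ‖(Z s).2‖ = W s := abs_of_pos hWs.1
        rw [h1]
        have := mul_nonneg (abs_nonneg h₁) hC₂w.le
        linarith [hWs.2.1, hw.1]
    have hCZ : C₁ * ‖Z s‖ * t ≤ C₁ * ((|h₁| + 2) * C₂ + 1) * t * w := by
      have := mul_le_mul_of_nonneg_right (mul_le_mul_of_nonneg_left hN hC₁0) ht.1.le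
      linarith
    have hh₁ : |h₁ * (w - W s)| ≤ |h₁| * (C₁ * ‖Z s‖ * t) := by
      rw [abs_mul]; exact mul_le_mul_of_nonneg_left hd2 (abs_nonneg _)
    have hh₁' := mul_le_mul_of_nonneg_left hCZ (abs_nonneg h₁)
    have hηW : η * W s ≤ η * (C₂ * w) := mul_le_mul_of_nonneg_left hWs.2.1 hη.1.le
    -- Four errors: the change of 1 - F along the characteristic, the initial error at s, the
    -- linearisation of h at 1, and the change of W.
    have hsplit : 1 - F (1 - w, t) - h₁ * w =
        (1 - F (1 - w, t) - (1 - F (1 - W s, s))) - (F (1 - W s, s) - h (1 - W s))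
          + (1 - h (1 - W s) - h₁ * W s) - h₁ * (w - W s) := by ring
    rw [hsplit]
    have h9 := (abs_sub ((1 - F (1 - w, t) - (1 - F (1 - W s, s)))
      - (F (1 - W s, s) - h (1 - W s)) + (1 - h (1 - W s) - h₁ * W s)) (h₁ * (w - W s))).trans
        (add_le_add_left ((abs_add_le _ _).trans (add_le_add_left (abs_sub _ _) _)) _)
    refine h9.trans ?_
    rw [hC₃]
    linarith
  have key2 : ∀ t ∈ Ioc (0 : ℝ) 1, |partialX F 1 t - h₁| ≤ C₃ * t := by
    intro t ht
    have hη : ∀ η ∈ Ioo (0 : ℝ) 1, |partialX F 1 t - h₁| ≤ C₃ * t + η * (1 + C₂) := by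
      intro η hη
      rw [abs_le]
      constructor
      · have := hF.le_partialX (C := h₁ - (C₃ * t + η * (1 + C₂))) ht.1 (by
          filter_upwards [key t ht η hη] with w hw
          linarith [(abs_le.1 hw).1])
        linarith
      · have := hF.partialX_le (C := h₁ + (C₃ * t + η * (1 + C₂))) ht.1 (by
          filter_upwards [key t ht η hη] with w hw
          linarith [(abs_le.1 hw).2])
        linarith
    have hlim : Tendsto (fun η : ℝ => C₃ * t + η * (1 + C₂)) (𝓝[>] 0) (𝓝 (C₃ * t)) := by
      have : Tendsto (fun η : ℝ => C₃ * t + η * (1 + C₂)) (𝓝 0) (𝓝 (C₃ * t + 0 * (1 + C₂))) :=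
        (by fun_prop : Continuous fun η : ℝ => C₃ * t + η * (1 + C₂)).tendsto 0
      rw [zero_mul, add_zero] at this
      exact this.mono_left nhdsWithin_le_nhds
    refine ge_of_tendsto hlim ?_
    filter_upwards [Ioo_mem_nhdsGT (zero_lt_one' ℝ)] with η h using hη η h
  rw [tendsto_iff_dist_tendsto_zero]
  have hlim : Tendsto (fun t : ℝ => C₃ * t) (𝓝[>] 0) (𝓝 0) := by
    have : Tendsto (fun t : ℝ => C₃ * t) (𝓝 0) (𝓝 (C₃ * 0)) :=
      (by fun_prop : Continuous fun t : ℝ => C₃ * t).tendsto 0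
    rw [mul_zero] at this
    exact this.mono_left nhdsWithin_le_nhds
  refine squeeze_zero' (Eventually.of_forall fun _ => dist_nonneg) ?_ hlim
  filter_upwards [Ioo_mem_nhdsGT (zero_lt_one' ℝ)] with t ht using key2 t ⟨ht.1, ht.2.le⟩

end IsTransportSolution

end SlopeBounds

/-! ### The generating function of the initial probabilities. -/

section GenFun

open Set Filter Topology

variable {p : ℕ → ℝ}

theorem genFun_hasFPowerSeriesOnBall (hrad : 0 < genRadius p) :
    HasFPowerSeriesOnBall (genFun p) (FormalMultilinearSeries.ofScalars ℝ p) 0 (genRadius p) := by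
  have h := (FormalMultilinearSeries.ofScalars ℝ p).hasFPowerSeriesOnBall hrad
  have heq : (FormalMultilinearSeries.ofScalars ℝ p).sum = genFun p := by
    funext x
    simp [FormalMultilinearSeries.sum, genFun, mul_comm]
  rwa [heq] at h

theorem genFun_hasSum {R x : ℝ} (hR : ENNReal.ofReal R ≤ genRadius p) (hx : |x| < R) :
    HasSum (fun k => p k * x ^ k) (genFun p x) := by
  have hR0 : 0 < R := (abs_nonneg x).trans_lt hx
  have hrad : 0 < genRadius p := (ENNReal.ofReal_pos.2 hR0).trans_le hR
  have hmem : x ∈ Metric.eball (0 : ℝ) (genRadius p) := by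
    rw [Metric.mem_eball, edist_dist, dist_zero_right, Real.norm_eq_abs]
    exact ((ENNReal.ofReal_lt_ofReal_iff hR0).2 hx).trans_le hR
  have h := (genFun_hasFPowerSeriesOnBall hrad).hasSum hmem
  simpa [mul_comm] using h

theorem genFun_contDiffOn {R : ℝ} (hR : ENNReal.ofReal R ≤ genRadius p) :
    ContDiffOn ℝ ∞ (genFun p) (Ioo (-R) R) := by
  rcases le_or_gt R 0 with h0 | h0
  · rw [Ioo_eq_empty (by linarith)]
    exact contDiffOn_empty
  · have hrad : 0 < genRadius p := (ENNReal.ofReal_pos.2 h0).trans_le hR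
    refine (genFun_hasFPowerSeriesOnBall hrad).analyticOnNhd.contDiffOn_of_completeSpace.mono ?_
    intro x hx
    rw [Metric.mem_eball, edist_dist, dist_zero_right, Real.norm_eq_abs]
    exact ((ENNReal.ofReal_lt_ofReal_iff h0).2 (abs_lt.2 hx)).trans_le hR

theorem exists_real_radius (hrad : 1 < genRadius p) :
    ∃ R : ℝ, 1 < R ∧ ENNReal.ofReal R ≤ genRadius p := by
  obtain ⟨R, h1, h2⟩ := ENNReal.lt_iff_exists_nnreal_btwn.1 hrad
  exact ⟨R, by exact_mod_cast h1, by simpa using h2.le⟩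

theorem genFun_one (hsum : HasSum p 1) : genFun p 1 = 1 := by
  simpa [genFun] using hsum.tsum_eq

theorem hasDerivAt_genFun_one (hrad : 1 < genRadius p) :
    HasDerivAt (genFun p) (deriv (genFun p) 1) 1 := by
  obtain ⟨R, h1, h2⟩ := exists_real_radius hrad
  exact (((genFun_contDiffOn h2).differentiableOn (by simp)).differentiableAt
    (isOpen_Ioo.mem_nhds ⟨by linarith, h1⟩)).hasDerivAt

/-- Termwise, 1 - x^k ≥ 1 - x for k ≥ 1, and these terms carry total mass 1 - p₀. -/
theorem one_sub_genFun_ge (hp : ∀ k, p k ∈ Icc (0 : ℝ) 1) (hsum : HasSum p 1) {x : ℝ}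
    (hx : x ∈ Icc (0 : ℝ) 1) : (1 - p 0) * (1 - x) ≤ 1 - genFun p x := by
  have hs : Summable (fun k => p k * x ^ k) :=
    hsum.summable.of_nonneg_of_le (fun k => mul_nonneg (hp k).1 (pow_nonneg hx.1 k))
      fun k => mul_le_of_le_one_right (hp k).1 (pow_le_one₀ hx.1 hx.2)
  have h1 : HasSum (fun k => p k * x ^ k) (genFun p x) := hs.hasSum
  have h2 : HasSum (fun k => p k * (1 - x ^ k)) (1 - genFun p x) := by
    simpa [mul_sub] using hsum.sub h1
  have h3 : HasSum (fun k => (p k - if k = 0 then p 0 else 0) * (1 - x)) ((1 - p 0) * (1 - x)) :=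
    (hsum.sub (hasSum_ite_eq 0 (p 0))).mul_right _
  refine hasSum_le (fun k => ?_) h3 h2
  rcases Nat.eq_zero_or_pos k with rfl | hk
  · simp
  · rw [if_neg hk.ne', sub_zero]
    refine mul_le_mul_of_nonneg_left ?_ (hp k).1
    linarith [pow_le_of_le_one hx.1 hx.2 hk.ne']

theorem zero_coeff_lt_one (hp : ∀ k, p k ∈ Icc (0 : ℝ) 1) (hsum : HasSum p 1)
    (hderiv : deriv (genFun p) 1 ≠ 0) : p 0 < 1 := by
  by_contra hcon
  push Not at hcon
  apply hderiv
  have h0 : p 0 = 1 := le_antisymm (hp 0).2 hcon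
  have hk : ∀ k, k ≠ 0 → p k = 0 := by
    intro k hk
    have h1 := sum_le_hasSum {0, k} (fun i _ => (hp i).1) hsum
    rw [Finset.sum_pair (Ne.symm hk), h0] at h1
    linarith [(hp k).1]
  have hconst : genFun p = fun _ => p 0 := by
    funext x
    rw [genFun, tsum_eq_single 0 fun k h => by rw [hk k h, zero_mul]]
    simp
  rw [hconst]
  simp

theorem deriv_genFun_one_pos (hp : ∀ k, p k ∈ Icc (0 : ℝ) 1) (hsum : HasSum p 1)
    (hrad : 1 < genRadius p) (hderiv : deriv (genFun p) 1 ≠ 0) : 0 < deriv (genFun p) 1 := by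
  refine lt_of_lt_of_le (sub_pos.2 (zero_coeff_lt_one hp hsum hderiv)) ?_
  have h1 := (hasDerivAt_genFun_one hrad).tendsto_slope.mono_left
    (nhdsWithin_mono (1 : ℝ) (fun x (hx : x ∈ Iio 1) => ne_of_lt hx))
  refine ge_of_tendsto h1 ?_
  filter_upwards [Ioo_mem_nhdsLT (zero_lt_one' ℝ)] with x hx
  have h2 := one_sub_genFun_ge hp hsum ⟨hx.1.le, hx.2.le⟩
  rw [slope_def_field, genFun_one hsum, ← neg_sub 1 (genFun p x), ← neg_sub 1 x, neg_div_neg_eq,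
    le_div_iff₀ (by linarith [hx.2])]
  exact h2

end GenFun

/-! ### Solutions of the Riccati equation near t = 0. -/

section RiccatiBounds

open Set Filter Topology

variable {A B a : ℝ} {v : ℝ → ℝ}

theorem riccati_neg_bounds (hA : 0 ≤ A) (hB : 0 ≤ B) (ha : 0 ≤ a)
    (hv : ∀ t, 0 < t → HasDerivAt v (A - B * v t - a * v t ^ 2) t) (hneg : ∀ t, 0 < t → v t < 0) :
    ∃ c C, 0 < c ∧ ∀ t ∈ Ioc (0 : ℝ) 1, c ≤ |v t| ∧ |v t| ≤ C := by
  set C := Real.exp B * (A - v 1) with hC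
  have hupper : ∀ t ∈ Ioc (0 : ℝ) 1, -v t ≤ C := by
    intro t ht
    -- The term A s absorbs the constant A and the weight exp(Bs) the linear term; the derivative is
    -- exp(Bs)(BAs + av²) ≥ 0.
    have hmono : MonotoneOn (fun s => Real.exp (B * s) * (A * s - v s)) (Icc t 1) :=
      monotoneOn_of_hasDerivAt (fun s hs => (((hasDerivAt_id s).const_mul B).exp).mul
        (((hasDerivAt_id s).const_mul A).sub (hv s (ht.1.trans_le hs.1)))) fun s hs => by
          have hs0 : 0 < s := ht.1.trans_le hs.1
          have h1 : 0 ≤ Real.exp (B * s) * (B * (A * s) + a * v s ^ 2) := by positivity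
          simp only [id, mul_one]
          linarith
    have h1 := hmono (left_mem_Icc.2 ht.2) (right_mem_Icc.2 ht.2) ht.2
    simp only [mul_one] at h1
    have h2 : 1 ≤ Real.exp (B * t) := Real.one_le_exp (mul_nonneg hB ht.1.le)
    have h3 : 0 ≤ A * t - v t := by have := hneg t ht.1; have := mul_nonneg hA ht.1.le; linarith
    have h4 := mul_le_mul_of_nonneg_right h2 h3
    have h5 := mul_nonneg hA ht.1.le
    rw [hC]
    linarith
  have hC0 : 0 ≤ C := by
    have := hupper 1 ⟨zero_lt_one, le_rfl⟩
    linarith [hneg 1 zero_lt_one]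
  refine ⟨-v 1 * Real.exp (-(a * C)), C,
    mul_pos (neg_pos.2 (hneg 1 zero_lt_one)) (Real.exp_pos _), fun t ht => ?_⟩
  rw [abs_of_neg (hneg t ht.1)]
  refine ⟨?_, hupper t ht⟩
  -- For v < 0, (-v)' ≤ av² ≤ aC(-v) by the bound just found.
  have hanti : AntitoneOn (fun s => -v s * Real.exp (-(a * C * s))) (Icc t 1) :=
    antitoneOn_of_hasDerivAt (fun s hs => (hv s (ht.1.trans_le hs.1)).neg.mul
      (((hasDerivAt_id s).const_mul (a * C)).neg.exp)) fun s hs => by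
        have hs0 : 0 < s := ht.1.trans_le hs.1
        have h1 := hneg s hs0
        have h2 := hupper s ⟨hs0, hs.2⟩
        have h3 : 0 ≤ a * (-v s * (C + v s)) :=
          mul_nonneg ha (mul_nonneg (by linarith) (by linarith))
        have h4 : 0 ≤ B * -v s := mul_nonneg hB (by linarith)
        have h5 : 0 ≤ (A - B * v s + a * (-v s * (C + v s))) * Real.exp (-(a * C * s)) :=
          mul_nonneg (by linarith) (Real.exp_pos _).le
        simp only [id, mul_one, Pi.neg_apply]
        linarith
  have h1 := hanti (left_mem_Icc.2 ht.2) (right_mem_Icc.2 ht.2) ht.2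
  simp only [mul_one] at h1
  have h2 : Real.exp (-(a * C * t)) ≤ 1 :=
    Real.exp_le_one_iff.2 (neg_nonpos.2 (mul_nonneg (mul_nonneg ha hC0) ht.1.le))
  exact h1.trans (mul_le_of_le_one_right (by linarith [hneg t ht.1]) h2)

/-- At level V the right-hand side is negative, so a solution that is at most V at time s remains
so; this is read backwards in time. -/
theorem riccati_gt_of_gt {V s t : ℝ}
    (hv : ∀ t, 0 < t → HasDerivAt v (A - B * v t - a * v t ^ 2) t)
    (hV : A - B * V - a * V ^ 2 < 0) (hs : 0 < s) (hst : s ≤ t) (ht : V < v t) : V < v s := by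
  by_contra hcon
  push Not at hcon
  have := image_le_of_deriv_right_lt_deriv_boundary (f := v) (f' := fun s => A - B * v s - a * v s ^ 2)
    (a := s) (b := t) (fun σ hσ => (hv σ (hs.trans_le hσ.1)).continuousAt.continuousWithinAt)
    (fun σ hσ => (hv σ (hs.trans_le hσ.1)).hasDerivWithinAt) (B := fun _ => V) (B' := fun _ => 0)
    hcon (fun σ => hasDerivAt_const σ V) (fun σ _ h => by rw [h]; exact hV) (right_mem_Icc.2 hst)
  linarith

theorem linear_bounded_above (hA : 0 ≤ A) (hB : 0 ≤ B)
    (hv : ∀ t, 0 < t → HasDerivAt v (A - B * v t) t) (hpos : ∀ t, 0 < t → 0 < v t) :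
    ∀ t ∈ Ioc (0 : ℝ) 1, v t ≤ Real.exp B * v 1 := by
  intro t ht
  have hmono : MonotoneOn (fun s => Real.exp (B * s) * v s) (Icc t 1) :=
    monotoneOn_of_hasDerivAt (fun s hs => (((hasDerivAt_id s).const_mul B).exp).mul
      (hv s (ht.1.trans_le hs.1))) fun s hs => by
        have h1 : 0 ≤ Real.exp (B * s) * A := by positivity
        simp only [id, mul_one]
        linarith
  have h1 := hmono (left_mem_Icc.2 ht.2) (right_mem_Icc.2 ht.2) ht.2
  simp only [mul_one] at h1
  have h2 : 1 ≤ Real.exp (B * t) := Real.one_le_exp (mul_nonneg hB ht.1.le)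
  exact (le_mul_of_one_le_left (hpos t ht.1).le h2).trans h1

/-- A solution of the Riccati equation is determined by its limit at `0`. -/
theorem riccati_unique {u : ℝ → ℝ} (hv : ∀ t, 0 < t → HasDerivAt v (A - B * v t - a * v t ^ 2) t)
    (hu : ∀ t, 0 ≤ t → HasDerivAt u (A - B * u t - a * u t ^ 2) t)
    (hlim : Tendsto v (𝓝[>] 0) (𝓝 (u 0))) {t : ℝ} (ht : 0 < t) : v t = u t := by
  -- The value of v at 0 carries no information and is replaced by the limit.
  set w := Function.update v 0 (u 0) with hw
  have hwv : ∀ s, 0 < s → w s = v s := fun s hs => Function.update_of_ne hs.ne' _ _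
  have hw0 : w 0 = u 0 := Function.update_self _ _ _
  have hwd : ∀ s, 0 < s → HasDerivAt w (A - B * w s - a * w s ^ 2) s := fun s hs => by
    rw [hwv s hs]
    refine (hv s hs).congr_of_eventuallyEq ?_
    filter_upwards [lt_mem_nhds hs] with r hr using hwv r hr
  have hwc : ContinuousOn w (Icc 0 t) := by
    intro s hs
    rcases hs.1.eq_or_lt with rfl | h
    · rw [hw, continuousWithinAt_update_same]
      refine hlim.mono_left (nhdsWithin_mono _ ?_)
      rintro x ⟨hx, hx0⟩
      exact lt_of_le_of_ne hx.1 (Ne.symm hx0)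
    · exact (hwd s h).continuousAt.continuousWithinAt
  have huc : ContinuousOn u (Icc 0 t) := fun s hs => (hu s hs.1).continuousAt.continuousWithinAt
  obtain ⟨C, hC⟩ := isCompact_Icc.exists_bound_of_continuousOn
    ((continuousOn_const (c := B)).add ((continuousOn_const (c := a)).mul (hwc.add huc)))
  have h := eq_zero_of_abs_deriv_le (e := fun s => w s - u s)
    (e' := fun s => -(B + a * (w s + u s)) * (w s - u s)) (C := C) ht.le (hwc.sub huc)
    (by simp [hw0]) (fun s hs => ((hwd s hs.1).sub (hu s hs.1.le)).congr_deriv (by ring))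
    (fun s hs => by
      rw [abs_mul, abs_neg]
      exact mul_le_mul_of_nonneg_right (hC s ⟨hs.1.le, hs.2.le⟩) (abs_nonneg _))
  rw [hwv t ht] at h
  linarith

end RiccatiBounds

/-! ### From the network model to the transport equation. -/

section Network

open Set Filter Topology

namespace NetworkRates

variable (P : NetworkRates)

/-- The rate of preferential attachment of links. -/
noncomputable def prefRate : ℝ := 2 * P.lp + P.np * P.m

/-- The rate of random attachment of links. -/
noncomputable def randRate : ℝ := 2 * P.lr + P.nr * P.m

/-- The rate of addition of nodes. -/
noncomputable def nodeRate : ℝ := P.nr + P.np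

/-- The constant term of the Riccati equation for the mean degree. -/
noncomputable def gainRate : ℝ := P.prefRate + P.randRate + P.nodeRate * P.m

/-- The linear coefficient of the Riccati equation for the mean degree. -/
noncomputable def lossRate : ℝ := P.ld + P.nodeRate

/-- The quadratic coefficient of the transport field, given the mean degree `v`. -/
noncomputable def coefB (v : ℝ → ℝ) (t : ℝ) : ℝ := P.ωp + P.prefRate / v t

/-- The linear coefficient of the transport field, given the mean degree `v`. -/
noncomputable def coefC (v : ℝ → ℝ) (t : ℝ) : ℝ := P.prefRate / v t - P.ωr - P.ld - P.nd * v t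

/-- The growth coefficient, given the mean degree `v`. -/
noncomputable def coefD (v : ℝ → ℝ) (t : ℝ) : ℝ := P.ωr * v t + P.randRate

theorem prefRate_nonneg : 0 ≤ P.prefRate := by
  have := P.lp_nonneg; have := P.np_nonneg; unfold prefRate; positivity

theorem randRate_nonneg : 0 ≤ P.randRate := by
  have := P.lr_nonneg; have := P.nr_nonneg; unfold randRate; positivity

theorem nodeRate_nonneg : 0 ≤ P.nodeRate := add_nonneg P.nr_nonneg P.np_nonneg

theorem gainRate_nonneg : 0 ≤ P.gainRate :=
  add_nonneg (add_nonneg P.prefRate_nonneg P.randRate_nonneg)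
    (mul_nonneg P.nodeRate_nonneg (Nat.cast_nonneg _))

theorem lossRate_nonneg : 0 ≤ P.lossRate := add_nonneg P.ld_nonneg P.nodeRate_nonneg

variable {P} {v : ℝ → ℝ} {t : ℝ}

theorem coefB_nonneg (hv : 0 < v t) : 0 ≤ P.coefB v t :=
  add_nonneg P.ωp_nonneg (div_nonneg P.prefRate_nonneg hv.le)

theorem coefC_le_coefB (hv : 0 < v t) : P.coefC v t ≤ P.coefB v t := by
  have := mul_nonneg P.nd_nonneg hv.le
  unfold coefC coefB
  linarith [P.ωr_nonneg, P.ωp_nonneg, P.ld_nonneg]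

theorem coefD_nonneg (hv : 0 < v t) : 0 ≤ P.coefD v t :=
  add_nonneg (mul_nonneg P.ωr_nonneg hv.le) P.randRate_nonneg

theorem contDiff_coefB (hv : ContDiff ℝ ∞ v) (h0 : ∀ t, v t ≠ 0) : ContDiff ℝ ∞ (P.coefB v) :=
  contDiff_const.add (contDiff_const.div hv h0)

theorem contDiff_coefC (hv : ContDiff ℝ ∞ v) (h0 : ∀ t, v t ≠ 0) : ContDiff ℝ ∞ (P.coefC v) :=
  (((contDiff_const.div hv h0).sub contDiff_const).sub contDiff_const).sub (contDiff_const.mul hv)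

theorem contDiff_coefD (hv : ContDiff ℝ ∞ v) : ContDiff ℝ ∞ (P.coefD v) :=
  (contDiff_const.mul hv).add contDiff_const

theorem continuousOn_coefB {s : Set ℝ} (hv : ContinuousOn v s) (h0 : ∀ t ∈ s, v t ≠ 0) :
    ContinuousOn (P.coefB v) s :=
  continuousOn_const.add (continuousOn_const.div hv h0)

theorem continuousOn_coefC {s : Set ℝ} (hv : ContinuousOn v s) (h0 : ∀ t ∈ s, v t ≠ 0) :
    ContinuousOn (P.coefC v) s :=
  (((continuousOn_const.div hv h0).sub continuousOn_const).sub continuousOn_const).sub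
    (continuousOn_const.mul hv)

theorem continuousOn_coefD {s : Set ℝ} (hv : ContinuousOn v s) : ContinuousOn (P.coefD v) s :=
  (continuousOn_const.mul hv).add continuousOn_const

/-- Multiplication by v turns q/v into the constant q, and the terms ω_r v from γv and δ cancel. The
factor 1 stands for F(1,t). -/
theorem linear_eq_riccati (hv : v t ≠ 0) :
    (P.coefC v t - P.nodeRate) * v t + P.coefD v t * 1 + P.nodeRate * P.m =
      P.gainRate - P.lossRate * v t - P.nd * v t ^ 2 := by
  unfold coefC coefD gainRate lossRate
  field_simp
  ring

theorem solvesTransportAt_congr {u : ℝ → ℝ} (h : v t = u t) {F : ℝ × ℝ → ℝ} {x n : ℝ} {m : ℕ}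
    (hF : SolvesTransportAt (P.coefB v) (P.coefC v) (P.coefD v) n m F x t) :
    SolvesTransportAt (P.coefB u) (P.coefC u) (P.coefD u) n m F x t := by
  unfold SolvesTransportAt coefB coefC coefD at *
  rwa [← h]

theorem partialT_eq_nonlocalRHS_iff {F : ℝ × ℝ → ℝ} {x : ℝ} :
    partialT F x t = nonlocalRHS P F x t ↔ SolvesTransportAt (P.coefB (partialX F 1))
      (P.coefC (partialX F 1)) (P.coefD (partialX F 1)) P.nodeRate P.m F x t := by
  have : nonlocalRHS P F x t =
      (x - 1) * ((x - 1) * P.coefB (partialX F 1) t + P.coefC (partialX F 1) t) * partialX F x t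
        + ((x - 1) * P.coefD (partialX F 1) t - P.nodeRate) * F (x, t)
        + P.nodeRate * x ^ P.m := by
    unfold nonlocalRHS coefB coefC coefD prefRate randRate nodeRate
    ring
  rw [SolvesTransportAt, this]

end NetworkRates

variable {P : NetworkRates} {p : ℕ → ℝ} {D : Set (ℝ × ℝ)} {F : ℝ × ℝ → ℝ}

theorem mem_frontier_of_strip_subset (hD : IsAdmissibleDomain D)
    (hsub : Icc (-1 : ℝ) 1 ×ˢ Ioi (0 : ℝ) ⊆ D) {x : ℝ} (hx : x ∈ Icc (-1 : ℝ) 1) :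
    (x, (0 : ℝ)) ∈ frontier D := by
  rw [hD.isOpen.frontier_eq]
  constructor
  · have h1 : Tendsto (fun s : ℝ => (x, s)) (𝓝[>] 0) (𝓝 (x, 0)) :=
      ((by fun_prop : Continuous fun s : ℝ => (x, s)).tendsto 0).mono_left nhdsWithin_le_nhds
    exact mem_closure_of_tendsto h1 (eventually_nhdsWithin_of_forall fun s hs => hsub ⟨hx, hs⟩)
  · intro hmem
    obtain ⟨ε, hε, hball⟩ := Metric.isOpen_iff.1 hD.isOpen _ hmem
    have h2 : (x, -(ε / 2)) ∈ D := hball (by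
      simp only [Metric.mem_ball, Prod.dist_eq, dist_self, Real.dist_eq, sub_zero, abs_neg,
        abs_of_pos (half_pos hε)]
      exact max_lt hε (by linarith))
    have := hD.subset_halfPlane _ h2
    simp only at this
    linarith

namespace IsNonlocalSolution

theorem eq_genFun (hF : IsNonlocalSolution P p D F) {x : ℝ} (hx : (x, (0 : ℝ)) ∈ frontier D) :
    F (x, 0) = genFun p x :=
  (hF.initial x hx).tsum_eq.symm

theorem solvesTransportAt (hF : IsNonlocalSolution P p D F) {x t : ℝ} (h : (x, t) ∈ D) :
    SolvesTransportAt (P.coefB (partialX F 1)) (P.coefC (partialX F 1)) (P.coefD (partialX F 1))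
      P.nodeRate P.m F x t :=
  NetworkRates.partialT_eq_nonlocalRHS_iff.1 (hF.equation x t h)

theorem differentiableAt (hF : IsNonlocalSolution P p D F) {z : ℝ × ℝ} (h : z ∈ D) :
    DifferentiableAt ℝ F z :=
  hF.differentiable.differentiableAt (hF.domain.isOpen.mem_nhds h)

theorem continuousOn_strip (hF : IsNonlocalSolution P p D F)
    (hsub : Icc (-1 : ℝ) 1 ×ˢ Ioi (0 : ℝ) ⊆ D) :
    ContinuousOn F (Icc (-1 : ℝ) 1 ×ˢ Ici (0 : ℝ)) := by
  refine hF.continuous.mono ?_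
  rintro ⟨x, t⟩ ⟨hx, ht⟩
  rcases (show (0 : ℝ) ≤ t from ht).eq_or_lt with rfl | h
  · exact Or.inr ⟨mem_frontier_of_strip_subset hF.domain hsub hx, rfl⟩
  · exact Or.inl (hsub ⟨hx, h⟩)

/-- The line x = 1 is a characteristic, along which the equation reduces to g' = -n(g-1) with g(0) =
1. -/
theorem eq_one (hF : IsNonlocalSolution P p D F) (hsub : Icc (-1 : ℝ) 1 ×ˢ Ioi (0 : ℝ) ⊆ D)
    (hsum : HasSum p 1) {t : ℝ} (ht : 0 < t) : F (1, t) = 1 := by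
  have h1 : (1 : ℝ) ∈ Icc (-1 : ℝ) 1 := ⟨by norm_num, le_rfl⟩
  have hd : ∀ s, 0 < s → HasDerivAt (fun s => F (1, s)) (-P.nodeRate * (F (1, s) - 1)) s := by
    intro s hs
    have h := SolvesTransportAt.hasDerivAt_comp (Y := fun _ => 0)
      (by simpa using hF.differentiableAt (hF.domain.line_mem s hs))
      (by simpa using hF.solvesTransportAt (hF.domain.line_mem s hs))
      ((hasDerivAt_const s (0 : ℝ)).congr_deriv (by simp))
    simp only [add_zero, one_pow] at h
    exact h.congr_deriv (by ring)
  have h := eq_zero_of_abs_deriv_le (e := fun s => F (1, s) - 1)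
    (e' := fun s => -P.nodeRate * (F (1, s) - 1)) (C := P.nodeRate) ht.le
    (((hF.continuousOn_strip hsub).comp (f := fun s : ℝ => ((1 : ℝ), s)) (by fun_prop)
      fun s hs => ⟨h1, hs.1⟩).sub continuousOn_const)
    (by simp [hF.eq_genFun (mem_frontier_of_strip_subset hF.domain hsub h1), genFun_one hsum])
    (fun s hs => (hd s hs.1).sub_const 1)
    (fun s _ => by rw [abs_mul, abs_neg, abs_of_nonneg P.nodeRate_nonneg])
  linarith

theorem isTransportSolution (hF : IsNonlocalSolution P p D F)
    (hsub : Icc (-1 : ℝ) 1 ×ˢ Ioi (0 : ℝ) ⊆ D) (hsum : HasSum p 1) :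
    IsTransportSolution (P.coefB (partialX F 1)) (P.coefC (partialX F 1))
      (P.coefD (partialX F 1)) P.nodeRate P.m (genFun p) F where
  differentiableAt x hx t ht := hF.differentiableAt (hsub ⟨⟨by linarith [hx.1], hx.2⟩, ht⟩)
  equation x hx t ht := hF.solvesTransportAt (hsub ⟨⟨by linarith [hx.1], hx.2⟩, ht⟩)
  eq_one t ht := hF.eq_one hsub hsum ht
  initial ε hε := by
    have huc : UniformContinuousOn F (Icc (-1 : ℝ) 1 ×ˢ Icc (0 : ℝ) 1) :=
      (isCompact_Icc.prod isCompact_Icc).uniformContinuousOn_of_continuous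
        ((hF.continuousOn_strip hsub).mono (prod_mono le_rfl fun s hs => hs.1))
    obtain ⟨s₀, hs₀, h⟩ := Metric.uniformContinuousOn_iff.1 huc ε hε
    refine ⟨min s₀ 1, lt_min hs₀ zero_lt_one, fun s hs x hx => ?_⟩
    have hx' : x ∈ Icc (-1 : ℝ) 1 := ⟨by linarith [hx.1], hx.2⟩
    have h1 := h (x, s) ⟨hx', hs.1.le, (hs.2.trans_le (min_le_right _ _)).le⟩ (x, 0)
      ⟨hx', le_rfl, zero_le_one⟩ (by
        simp only [Prod.dist_eq, dist_self, Real.dist_eq, sub_zero, abs_of_pos hs.1]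
        exact max_lt hs₀ (hs.2.trans_le (min_le_left _ _)))
    rwa [Real.dist_eq, hF.eq_genFun (mem_frontier_of_strip_subset hF.domain hsub hx')] at h1

theorem hasDerivAt_partialX (hF : IsNonlocalSolution P p D F) (hF2 : ContDiffOn ℝ 2 F D)
    (hsub : Icc (-1 : ℝ) 1 ×ˢ Ioi (0 : ℝ) ⊆ D) (hsum : HasSum p 1) {t : ℝ} (ht : 0 < t) :
    HasDerivAt (partialX F 1) (P.gainRate - P.lossRate * partialX F 1 t
      - P.nd * partialX F 1 t ^ 2) t := by
  have hmem := hF.domain.isOpen.mem_nhds (hF.domain.line_mem t ht)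
  have h := hasDerivAt_partialX_one (hF2.contDiffAt hmem)
    (by filter_upwards [hmem] with z hz using hF.solvesTransportAt hz)
  rw [hF.eq_one hsub hsum ht] at h
  exact h.congr_deriv (NetworkRates.linear_eq_riccati (hF.denom_ne_zero t ht))

/-- The mean degree of a solution is bounded and bounded away from zero near `t = 0`. -/
theorem partialX_bounds (hF : IsNonlocalSolution P p D F) (hF2 : ContDiffOn ℝ 2 F D)
    (hsub : Icc (-1 : ℝ) 1 ×ˢ Ioi (0 : ℝ) ⊆ D) (hp : ∀ k, p k ∈ Icc (0 : ℝ) 1)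
    (hsum : HasSum p 1) (hrad : 1 < genRadius p) (hderiv : deriv (genFun p) 1 ≠ 0) :
    ∃ c C, 0 < c ∧ ∀ t ∈ Ioc (0 : ℝ) 1, c ≤ |partialX F 1 t| ∧ |partialX F 1 t| ≤ C := by
  have hT := hF.isTransportSolution hsub hsum
  have hv : ∀ t, 0 < t → HasDerivAt (partialX F 1) (P.gainRate - P.lossRate * partialX F 1 t
      - P.nd * partialX F 1 t ^ 2) t := fun t ht => hF.hasDerivAt_partialX hF2 hsub hsum ht
  have hne := hF.denom_ne_zero
  set v := partialX F 1
  have hvc : ContinuousOn v (Ioi 0) := fun t ht => (hv t ht).continuousAt.continuousWithinAt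
  have hBc := NetworkRates.continuousOn_coefB (P := P) hvc fun t ht => hne t ht
  have hCc := NetworkRates.continuousOn_coefC (P := P) hvc fun t ht => hne t ht
  have hDc := NetworkRates.continuousOn_coefD (P := P) hvc
  have hsign : (∀ t, 0 < t → v t < 0) ∨ (∀ t, 0 < t → 0 < v t) := by
    by_contra hcon
    push Not at hcon
    obtain ⟨⟨s, hs, hs0⟩, t, ht, ht0⟩ := hcon
    obtain ⟨r, hr, hr0⟩ := isPreconnected_Ioi.intermediate_value (mem_Ioi.2 ht) (mem_Ioi.2 hs) hvc
      ⟨ht0, hs0⟩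
    exact hne r hr hr0
  -- A negative v is not excluded yet, but the Riccati equation alone bounds it; the positive limit
  -- obtained later rules it out.
  rcases hsign with hneg | hpos
  · exact riccati_neg_bounds P.gainRate_nonneg P.lossRate_nonneg P.nd_nonneg hv hneg
  have hdG := hasDerivAt_genFun_one hrad
  have hh₁ := deriv_genFun_one_pos hp hsum hrad hderiv
  set h₁ := deriv (genFun p) 1
  obtain ⟨C, hC⟩ : ∃ C, ∀ t ∈ Ioc (0 : ℝ) 1, v t ≤ C := by
    rcases P.nd_nonneg.eq_or_lt with h0 | h0
    · exact ⟨_, linear_bounded_above P.gainRate_nonneg P.lossRate_nonneg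
        (fun t ht => (hv t ht).congr_deriv (by rw [← h0]; ring)) hpos⟩
    have hq := P.prefRate_nonneg
    have hA := P.gainRate_nonneg
    -- Chosen so that n_d V = n_d + A + 2q with V ≥ 1. The Riccati field is then negative at V, and
    -- for v > V one has q/v ≤ n_d v/2, hence -γ ≥ n_d v/2.
    set V := 1 + P.gainRate / P.nd + 2 * P.prefRate / P.nd with hV
    have hV1 : 1 ≤ V := by
      have : 0 ≤ P.gainRate / P.nd + 2 * P.prefRate / P.nd := by positivity
      linarith
    have hVnd : P.nd * V = P.nd + P.gainRate + 2 * P.prefRate := by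
      rw [hV]; field_simp
    have hVneg : P.gainRate - P.lossRate * V - P.nd * V ^ 2 < 0 := by
      have h1 : 0 ≤ P.lossRate * V := mul_nonneg P.lossRate_nonneg (by linarith)
      have h2 : P.nd * V ≤ P.nd * V ^ 2 := mul_le_mul_of_nonneg_left (by nlinarith) h0.le
      linarith
    have hnm : 0 ≤ P.nodeRate * P.m := mul_nonneg P.nodeRate_nonneg (Nat.cast_nonneg _)
    have hr := P.randRate_nonneg
    have hωr := P.ωr_nonneg
    -- Makes S n_d v/2 = (ω_r + r + nm)v with r = `randRate`, which dominates δ + nm when v ≥ 1.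
    set S := 2 * (P.ωr + P.randRate + P.nodeRate * P.m) / P.nd with hS
    have hS0 : 0 ≤ S := by positivity
    obtain ⟨w₀, hw₀, hw⟩ : ∃ w₀ > 0, ∀ w ∈ Ioo 0 w₀, 1 - genFun p (1 - w) ≤ (h₁ + 1) * w := by
      have h1 := (hasDerivAt_iff_isLittleO.1 hdG).def zero_lt_one
      obtain ⟨w₀, hw₀, h⟩ := Metric.eventually_nhds_iff.1 h1
      refine ⟨w₀, hw₀, fun w hw => ?_⟩
      have h2 := h (y := 1 - w) (by
        rw [Real.dist_eq, show 1 - w - 1 = -w by ring, abs_neg, abs_of_pos hw.1]; exact hw.2)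
      rw [genFun_one hsum, Real.norm_eq_abs, Real.norm_eq_abs, show 1 - w - 1 = -w by ring,
        abs_neg, abs_of_pos (a := w) hw.1, smul_eq_mul] at h2
      linarith [(abs_le.1 h2).1]
    refine ⟨max V (S + (h₁ + 1) + 1), fun t ht => ?_⟩
    -- If v(t) > V, then v > V on all of (0,t], so the spreading of characteristics dominates from
    -- time 0 on.
    rcases le_or_gt (v t) V with hle | hgt
    · exact hle.trans (le_max_left _ _)
    refine le_trans ?_ (le_max_right _ _)
    have hgtV : ∀ s ∈ Ioc 0 t, V < v s := fun s hs =>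
      riccati_gt_of_gt hv hVneg hs.1 hs.2 hgt
    have hCle : ∀ s ∈ Ioc 0 t, P.nd * v s / 2 ≤ -P.coefC v s := fun s hs => by
      have h1 := hgtV s hs
      have h2 : P.prefRate / v s ≤ P.prefRate := div_le_self hq (by linarith)
      have h3 : P.nd * V ≤ P.nd * v s := mul_le_mul_of_nonneg_left h1.le h0.le
      unfold NetworkRates.coefC
      linarith [P.ld_nonneg]
    refine hT.upper_bound hBc hCc hDc P.nodeRate_nonneg ht.1 hS0 (by linarith)
      (fun s hs => NetworkRates.coefB_nonneg (hpos s hs.1)) (fun s hs => ?_)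
      (fun s hs => NetworkRates.coefD_nonneg (hpos s hs.1)) (fun s hs => ?_) hw₀ hw
    · have := hCle s hs
      have := mul_pos h0 (hpos s hs.1)
      linarith
    · refine le_trans ?_ (mul_le_mul_of_nonneg_left (hCle s hs) hS0)
      have h1 : 1 ≤ v s := hV1.trans (hgtV s hs).le
      have h2 : S * (P.nd * v s / 2) = (P.ωr + P.randRate + P.nodeRate * P.m) * v s := by
        rw [hS]; field_simp
      rw [h2, NetworkRates.coefD]
      nlinarith [mul_le_mul_of_nonneg_left h1 hr, mul_le_mul_of_nonneg_left h1 hnm]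
  -- A common bound for β - γ = ω_p + ω_r + l_d + n_d v, free of q/v, and for δ + n.
  set M := (P.ωr + P.ωp + P.ld + P.nd * C) + (P.ωr * C + P.randRate + P.nodeRate) with hM
  have hC0 : 0 ≤ C := (hpos 1 zero_lt_one).le.trans (hC 1 ⟨zero_lt_one, le_rfl⟩)
  have hndC := mul_nonneg P.nd_nonneg hC0
  have hωC := mul_nonneg P.ωr_nonneg hC0
  have hκ : 0 < 1 - p 0 := sub_pos.2 (zero_coeff_lt_one hp hsum hderiv)
  refine ⟨Real.exp (-M) * ((1 - p 0) * Real.exp (-M) / 2), C, by positivity, fun t ht => ?_⟩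
  rw [abs_of_pos (hpos t ht.1)]
  refine ⟨?_, hC t ht⟩
  refine hT.lower_bound hBc hCc hDc P.nodeRate_nonneg hκ
    (fun s hs => NetworkRates.coefB_nonneg (hpos s hs.1))
    (fun s hs => NetworkRates.coefC_le_coefB (hpos s hs.1))
    (fun s hs => NetworkRates.coefD_nonneg (hpos s hs.1)) (fun s hs => ?_) (fun s hs => ?_)
    (fun x hx => one_sub_genFun_ge hp hsum hx) ht
  · have h1 := mul_le_mul_of_nonneg_left (hC s hs) P.nd_nonneg
    unfold NetworkRates.coefC NetworkRates.coefB
    linarith [P.randRate_nonneg, P.nodeRate_nonneg]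
  · have h1 := mul_le_mul_of_nonneg_left (hC s hs) P.ωr_nonneg
    unfold NetworkRates.coefD
    linarith [P.ωr_nonneg, P.ωp_nonneg, P.ld_nonneg]

/-- The mean degree of a solution attains its initial value. -/
theorem tendsto_partialX (hF : IsNonlocalSolution P p D F) (hF2 : ContDiffOn ℝ 2 F D)
    (hsub : Icc (-1 : ℝ) 1 ×ˢ Ioi (0 : ℝ) ⊆ D) (hp : ∀ k, p k ∈ Icc (0 : ℝ) 1)
    (hsum : HasSum p 1) (hrad : 1 < genRadius p) (hderiv : deriv (genFun p) 1 ≠ 0) :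
    Tendsto (partialX F 1) (𝓝[>] 0) (𝓝 (deriv (genFun p) 1)) := by
  obtain ⟨c, C, hc, hb⟩ := hF.partialX_bounds hF2 hsub hp hsum hrad hderiv
  have hvc : ContinuousOn (partialX F 1) (Ioi 0) := fun t ht =>
    (hF.hasDerivAt_partialX hF2 hsub hsum ht).continuousAt.continuousWithinAt
  have hC0 : 0 ≤ C := (abs_nonneg _).trans (hb 1 ⟨zero_lt_one, le_rfl⟩).2
  have hq := P.prefRate_nonneg
  have hq' : 0 ≤ P.prefRate / c := div_nonneg hq hc.le
  have hndC := mul_nonneg P.nd_nonneg hC0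
  have hωC := mul_nonneg P.ωr_nonneg hC0
  have hdiv : ∀ t ∈ Ioc (0 : ℝ) 1, |P.prefRate / partialX F 1 t| ≤ P.prefRate / c := fun t ht => by
    rw [abs_div, abs_of_nonneg hq]
    exact div_le_div_of_nonneg_left hq hc (hb t ht).1
  have hω := P.ωr_nonneg
  have hωp := P.ωp_nonneg
  have hld := P.ld_nonneg
  have hr := P.randRate_nonneg
  refine (hF.isTransportSolution hsub hsum).tendsto_partialX
    (NetworkRates.continuousOn_coefB hvc hF.denom_ne_zero)
    (NetworkRates.continuousOn_coefC hvc hF.denom_ne_zero) P.nodeRate_nonneg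
    (C := P.ωp + P.prefRate / c + P.ωr + P.ld + P.nd * C + P.ωr * C + P.randRate)
    (fun t ht => ?_) (fun t ht => ?_) (fun t ht => ?_) (genFun_one hsum)
    (hasDerivAt_genFun_one hrad)
  · have h1 := abs_le.1 (hdiv t ht)
    unfold NetworkRates.coefB
    rw [abs_le]
    constructor <;> linarith
  · have h1 := abs_le.1 (hdiv t ht)
    have h2 : |P.nd * partialX F 1 t| ≤ P.nd * C := by
      rw [abs_mul, abs_of_nonneg P.nd_nonneg]
      exact mul_le_mul_of_nonneg_left (hb t ht).2 P.nd_nonneg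
    have h3 := abs_le.1 h2
    unfold NetworkRates.coefC
    rw [abs_le]
    constructor <;> linarith
  · have h2 : |P.ωr * partialX F 1 t| ≤ P.ωr * C := by
      rw [abs_mul, abs_of_nonneg P.ωr_nonneg]
      exact mul_le_mul_of_nonneg_left (hb t ht).2 P.ωr_nonneg
    have h3 := abs_le.1 h2
    unfold NetworkRates.coefD
    rw [abs_le]
    constructor <;> linarith

end IsNonlocalSolution

/-- The derivative at `x = 1` of the solution of the transport equation whose coefficients come
from a positive solution `u` of the Riccati equation is `u`. -/
theorem partialX_transportSol_one {R h₁ : ℝ} (hR : 1 < R) {h : ℝ → ℝ}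
    (hh : ContDiffOn ℝ ∞ h (Ioo (-R) R)) (hh1 : h 1 = 1) (hd : HasDerivAt h h₁ 1) {u : ℝ → ℝ}
    (hu : ContDiff ℝ ∞ u) (hu0 : ∀ t, 0 < u t) (hui : u 0 = h₁)
    (hu' : ∀ t, 0 ≤ t →
      HasDerivAt u (P.gainRate - P.lossRate * u t - P.nd * u t ^ 2) t) {t : ℝ} (ht : 0 ≤ t) :
    partialX (transportSol (P.coefB u) (P.coefC u) (P.coefD u) P.nodeRate P.m h) 1 t = u t := by
  have hβ : ContDiff ℝ ∞ (P.coefB u) := NetworkRates.contDiff_coefB hu fun t => (hu0 t).ne'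
  have hγ : ContDiff ℝ ∞ (P.coefC u) := NetworkRates.contDiff_coefC hu fun t => (hu0 t).ne'
  have hδ : ContDiff ℝ ∞ (P.coefD u) := NetworkRates.contDiff_coefD hu
  have hβ0 : ∀ t, 0 ≤ P.coefB u t := fun t => NetworkRates.coefB_nonneg (hu0 t)
  have hγβ : ∀ t, P.coefC u t ≤ P.coefB u t := fun t => NetworkRates.coefC_le_coefB (hu0 t)
  set G := transportSol (P.coefB u) (P.coefC u) (P.coefD u) P.nodeRate P.m h with hG
  have hGc := contDiffOn_transportSol hβ hγ hδ hβ0 P.nodeRate P.m hh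
  have hopen := isOpen_transportDomain hβ hγ R
  have hmem : ∀ s, 0 ≤ s → (1, s) ∈ transportDomain (P.coefB u) (P.coefC u) R := fun s hs =>
    mem_transportDomain hβ.continuous hγ.continuous hβ0 hγβ hR ⟨by norm_num, le_rfl⟩ hs
  have hsol := fun x t (hz : (x, t) ∈ transportDomain (P.coefB u) (P.coefC u) R) =>
    solvesTransportAt_transportSol hβ hγ hδ hβ0 P.nodeRate P.m hh hz
  have hG1 : ∀ s, 0 ≤ s → G (1, s) = 1 := by
    intro s hs
    have hGd : ∀ r, 0 ≤ r → HasDerivAt (fun r => G (1, r)) (-P.nodeRate * (G (1, r) - 1)) r := by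
      intro r hr
      have h := SolvesTransportAt.hasDerivAt_comp (Y := fun _ => 0)
        (by simpa using (hGc.differentiableOn (by simp)).differentiableAt (hopen.mem_nhds (hmem r hr)))
        (by simpa using hsol 1 r (hmem r hr))
        ((hasDerivAt_const r (0 : ℝ)).congr_deriv (by simp))
      simp only [add_zero, one_pow] at h
      exact h.congr_deriv (by ring)
    have h := eq_zero_of_abs_deriv_le (e := fun s => G (1, s) - 1)
      (e' := fun s => -P.nodeRate * (G (1, s) - 1)) (C := P.nodeRate) hs
      (fun r hr => ((hGd r hr.1).sub_const 1).continuousAt.continuousWithinAt)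
      (by simp only [hG, transportSol_zero, hh1, sub_self])
      (fun r hr => (hGd r hr.1.le).sub_const 1)
      (fun r _ => by rw [abs_mul, abs_neg, abs_of_nonneg P.nodeRate_nonneg])
    linarith
  have hGx : ∀ s, 0 ≤ s → HasDerivAt (partialX G 1)
      ((P.coefC u s - P.nodeRate) * partialX G 1 s + P.coefD u s * 1 + P.nodeRate * P.m) s := by
    intro s hs
    have hn := hopen.mem_nhds (hmem s hs)
    have h := hasDerivAt_partialX_one ((hGc.contDiffAt hn).of_le
      (show ((2 : ℕ∞) : WithTop ℕ∞) ≤ ∞ from WithTop.coe_le_coe.2 le_top))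
      (by filter_upwards [hn] with z hz using hsol z.1 z.2 hz)
    rwa [← hG, hG1 s hs] at h
  have hGx0 : partialX G 1 0 = u 0 := by
    have : (fun y => G (y, 0)) = h := funext fun y => transportSol_zero _ _ _ _
    rw [partialX, this, hd.deriv, hui]
  obtain ⟨C, hC⟩ := (isCompact_Icc (a := (0 : ℝ)) (b := t)).exists_bound_of_continuousOn
    (f := fun s => P.coefC u s - P.nodeRate) (hγ.continuous.sub continuous_const).continuousOn
  -- With coefficients frozen at u, the equation for G_x(1,·) is linear, and u solves it too because
  -- of its Riccati equation.
  have h := eq_zero_of_abs_deriv_le (e := fun s => partialX G 1 s - u s)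
    (e' := fun s => (P.coefC u s - P.nodeRate) * (partialX G 1 s - u s)) (C := C) ht
    (fun r hr => ((hGx r hr.1).sub (hu' r hr.1)).continuousAt.continuousWithinAt)
    (by rw [hGx0, sub_self])
    (fun r hr => ((hGx r hr.1.le).sub (hu' r hr.1.le)).congr_deriv (by
      rw [← NetworkRates.linear_eq_riccati (hu0 r).ne']; ring))
    (fun r hr => by
      rw [abs_mul]
      exact mul_le_mul_of_nonneg_right (hC r ⟨hr.1.le, hr.2.le⟩) (abs_nonneg _))
  linarith

/-- At t = 0, `charL` equals 1, and the closed form of the defining inequality reads |x| ≤ R. -/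
theorem initialBoundary_transportDomain_subset {β γ : ℝ → ℝ} (hβ : ContDiff ℝ ∞ β)
    (hγ : ContDiff ℝ ∞ γ) {R x : ℝ}
    (hx : (x, (0 : ℝ)) ∈ frontier (transportDomain β γ R ∩ {z | 0 < z.2})) : |x| ≤ R := by
  have hL := (contDiff_charL hβ hγ).continuous
  have hclosed : IsClosed {z : ℝ × ℝ |
      |charL β γ z.1 z.2 + (z.1 - 1)| ≤ R * charL β γ z.1 z.2} :=
    isClosed_le (hL.add (by fun_prop)).abs (hL.const_mul R)
  have h := closure_minimal (fun z hz => hz.1.2.le) hclosed (frontier_subset_closure hx)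
  simpa [charL] using h

end Network

/-! ### Existence and uniqueness for the nonlocal problem. -/

theorem theorem3 (P : NetworkRates) (p : ℕ → ℝ)
    (hp : ∀ k, p k ∈ Set.Icc (0 : ℝ) 1) (hsum : HasSum p 1)
    (hrad : 1 < genRadius p) (hderiv : deriv (genFun p) 1 ≠ 0) :
    ∃ (D : Set (ℝ × ℝ)) (G : ℝ × ℝ → ℝ),
      IsOpen D ∧ Set.Icc (-1 : ℝ) 1 ×ˢ Set.Ioi (0 : ℝ) ⊆ D ∧
      ContDiffOn ℝ ∞ G D ∧ IsNonlocalSolution P p D G ∧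
      ∀ F : ℝ × ℝ → ℝ, ContDiffOn ℝ 2 F D → IsNonlocalSolution P p D F → Set.EqOn F G D := by
  obtain ⟨R, hR, hRr⟩ := exists_real_radius hrad
  -- The domain uses ρ < R so that boundary points at t = 0, where only |x| ≤ ρ is known, remain
  -- inside the interval of convergence and inside the larger domain where G is smooth.
  obtain ⟨ρ, hρ, hρR⟩ := exists_between hR
  have hh := genFun_contDiffOn hRr
  have hd := hasDerivAt_genFun_one hrad
  obtain ⟨u, hu, hu0, hui, hu'⟩ := exists_riccati P.gainRate_nonneg P.lossRate_nonneg P.nd_nonneg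
    (deriv_genFun_one_pos hp hsum hrad hderiv)
  have hβ : ContDiff ℝ ∞ (P.coefB u) := NetworkRates.contDiff_coefB hu fun t => (hu0 t).ne'
  have hγ : ContDiff ℝ ∞ (P.coefC u) := NetworkRates.contDiff_coefC hu fun t => (hu0 t).ne'
  have hδ : ContDiff ℝ ∞ (P.coefD u) := NetworkRates.contDiff_coefD hu
  have hβ0 : ∀ t, 0 ≤ P.coefB u t := fun t => NetworkRates.coefB_nonneg (hu0 t)
  have hγβ : ∀ t, P.coefC u t ≤ P.coefB u t := fun t => NetworkRates.coefC_le_coefB (hu0 t)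
  set G := transportSol (P.coefB u) (P.coefC u) (P.coefD u) P.nodeRate P.m (genFun p) with hG
  set D := transportDomain (P.coefB u) (P.coefC u) ρ ∩ {z | 0 < z.2} with hD
  have hDo : IsOpen D :=
    (isOpen_transportDomain hβ hγ ρ).inter (isOpen_lt continuous_const continuous_snd)
  have hsub : Set.Icc (-1 : ℝ) 1 ×ˢ Set.Ioi (0 : ℝ) ⊆ D := fun z hz =>
    ⟨mem_transportDomain hβ.continuous hγ.continuous hβ0 hγβ hρ hz.1 (le_of_lt hz.2), hz.2⟩
  have hDR : D ⊆ transportDomain (P.coefB u) (P.coefC u) R := fun z hz =>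
    transportDomain_mono hρR.le hz.1
  have hGc := contDiffOn_transportSol hβ hγ hδ hβ0 P.nodeRate P.m hh
  have hGx : ∀ t, 0 ≤ t → partialX G 1 t = u t := fun t ht =>
    partialX_transportSol_one hR hh (genFun_one hsum) hd hu hu0 hui hu' ht
  have hbd : ∀ x : ℝ, (x, (0 : ℝ)) ∈ frontier D → |x| < R := fun x hx =>
    (initialBoundary_transportDomain_subset hβ hγ hx).trans_lt hρR
  have hGsol : ∀ x t, (x, t) ∈ D → SolvesTransportAt (P.coefB u) (P.coefC u) (P.coefD u)
      P.nodeRate P.m G x t := fun x t hz =>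
    solvesTransportAt_transportSol hβ hγ hδ hβ0 P.nodeRate P.m hh (hDR hz)
  have hsolG : IsNonlocalSolution P p D G :=
    { domain := ⟨hDo, fun z hz => le_of_lt hz.2, fun t ht =>
        hsub ⟨⟨by norm_num, le_rfl⟩, ht⟩⟩
      differentiable := (hGc.mono hDR).differentiableOn (by simp)
      continuous := by
        refine hGc.continuousOn.mono (Set.union_subset hDR ?_)
        rintro ⟨x, t⟩ ⟨hz, rfl⟩
        have := hbd x hz
        exact ⟨by simp [charL], by simpa [charL] using this⟩
      denom_ne_zero := fun t ht => by rw [hGx t ht.le]; exact (hu0 t).ne'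
      equation := fun x t hz => NetworkRates.partialT_eq_nonlocalRHS_iff.2
        (NetworkRates.solvesTransportAt_congr (hGx t (le_of_lt hz.2)).symm (hGsol x t hz))
      initial := fun x hx => by
        rw [hG, transportSol_zero]
        exact genFun_hasSum hRr (hbd x hx) }
  refine ⟨D, G, hDo, hsub, hGc.mono hDR, hsolG, fun F hF2 hF => ?_⟩
  have hFx : ∀ t, 0 < t → partialX F 1 t = u t := fun t ht =>
    riccati_unique (fun t ht => hF.hasDerivAt_partialX hF2 hsub hsum ht) hu'
      (by rw [hui]; exact hF.tendsto_partialX hF2 hsub hp hsum hrad hderiv) ht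
  exact transport_unique hβ hγ hδ hβ0 hD hF.differentiable hsolG.differentiable
    (fun x t hz => NetworkRates.solvesTransportAt_congr (hFx t hz.2) (hF.solvesTransportAt hz))
    hGsol hF.continuous hsolG.continuous
    (fun x hx => (hF.eq_genFun hx).trans (hsolG.eq_genFun hx).symm)
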